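/- Corollary 4.9. For $g\in L^1(\mathbb R)\cap L^2(\mathbb R)$ let $[\mathcal Fg](t)=(2\pi)^{-1/2}\int e^{-itx}g(x)\,dx$, extended to $L^2(\mathbb R)$ by Plancherel's theorem, and let $\|g\|_s^2=\int(1+t^2)^s|[\mathcal Fg](t)|^2\,dt\in[0,\infty]$ for $g\in L^2(\mathbb R)$. Let $\mathcal D$ be the set of probability densities on $\mathbb R$ that belong to $L^2(\mathbb R)$, and for $\rho>0$ let $H_p^\rho=\{f\in\mathcal D:\|f\|_p^2\le\rho\}$. For $a,d>0$ let $\mathcal D_{a,d}$ be the set of all $f\in\mathcal D$ with $$d\le(1+t^2)^a\,\bigl|\ln(|[\mathcal Ff](t)|^2)\bigr|^{-1}\le d^{-1}\quad\text{for all }t\in\mathbb R,$$ and let $\mathcal D_a=\bigcup_{d>0}\mathcal D_{a,d}$ be the set of supersmooth densities with parameter $a$. One observes $Y_1,\dots,Y_n$ i.i.d. with density $f_Y(y)=\int f_X(x)f_\epsilon(y-x)\,dx$ and, independently of them, $\epsilon_1,\dots,\epsilon_m$ i.i.d. with density $f_\epsilon$, where $f_X,f_\epsilon\in\mathcal D$.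 An estimator $\widehat f_X$ is a measurable function of the $n+m$ observations with values in $L^2(\mathbb R)$. Let $a>0$, $0\le s<p$ and $\rho>0$. Then there is a constant $C>0$, which does not depend on $n$ and $m$, such that for all $n,m\ge 2$ $$\inf_{\widehat f_X}\ \sup_{f_X\in H_p^\rho,\ f_\epsilon\in\mathcal D_a}\mathbb E\|\widehat f_X-f_X\|_s^2\ \ge\ C\bigl\{(\log n)^{-(p-s)/a}+(\log m)^{-(p-s)/a}\bigr\}.$$ The same holds when the constant in the supersmoothness condition is held fixed: if $0<d<d'$ and $\mathcal D_{a,d'}\neq\emptyset$, then there is $C>0$, which does not depend on $n$ and $m$, such that for all $n,m\ge2$ the bound holds with $\mathcal D_{a,d}$ in place of $\mathcal D_a$. -/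

import Mathlib

open MeasureTheory
open scoped FourierTransform ENNReal

noncomputable section

namespace Deconvolution

/-- A probability density on the real line that belongs to `L²(ℝ)`. -/
structure L2Density where
  toFun : ℝ → ℝ
  nonneg : ∀ x, 0 ≤ toFun x
  integrable : Integrable toFun volume
  integral_eq_one : ∫ x, toFun x = 1
  memLp : MemLp toFun 2 volume

/-- The element of `L²(ℝ)` represented by a density. -/
def L2Density.toL2 (f : L2Density) : Lp ℂ 2 (volume : Measure ℝ) :=
  (f.memLp.ofReal (K := ℂ)).toLp (fun x => (f.toFun x : ℂ))

/-- The unitary Fourier transform `(2π)^{-1/2} ∫ exp(-itx) g(x) dx` of an integrable function,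
defined at every point `t`. -/
def fourierInt (g : ℝ → ℝ) (t : ℝ) : ℂ :=
  ((Real.sqrt (2 * Real.pi))⁻¹ : ℝ) * ∫ x : ℝ, Complex.exp (-(Complex.I * t * x)) * (g x : ℂ)

/-- The same Fourier transform on `L²(ℝ)`, as a function defined almost everywhere. The Plancherel
transform `𝓕` extends `ξ ↦ ∫ exp(-2πixξ) g(x) dx`, which explains the rescaling. -/
def fourierL2 (g : Lp ℂ 2 (volume : Measure ℝ)) (t : ℝ) : ℂ :=
  ((Real.sqrt (2 * Real.pi))⁻¹ : ℝ) * (𝓕 g : Lp ℂ 2 (volume : Measure ℝ)) (t / (2 * Real.pi))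

/-- The squared Sobolev norm `‖g‖_s² = ∫ (1 + t²)^s |F g (t)|² dt`, with values in `[0, ∞]`;
it is finite exactly for `g` in the Sobolev space `H_s`. -/
def sobolevSq (s : ℝ) (g : Lp ℂ 2 (volume : Measure ℝ)) : ℝ≥0∞ :=
  ∫⁻ t : ℝ, ENNReal.ofReal ((1 + t ^ 2) ^ s * ‖fourierL2 g t‖ ^ 2)

/-- The densities in the Sobolev class `H_p^ρ = {f : ‖f‖_p² ≤ ρ}`. -/
def sobolevDensities (p ρ : ℝ) : Set L2Density :=
  {f | sobolevSq p f.toL2 ≤ ENNReal.ofReal ρ}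

/-- The densities that are supersmooth with parameter `a` and constant `d`:
`d ≤ (1 + t²)^a |ln |F f (t)|²|⁻¹ ≤ d⁻¹` for all real `t`. -/
def supersmoothWith (a d : ℝ) : Set L2Density :=
  {f | ∀ t : ℝ,
    d ≤ (1 + t ^ 2) ^ a * |Real.log (‖fourierInt f.toFun t‖ ^ 2)|⁻¹ ∧
    (1 + t ^ 2) ^ a * |Real.log (‖fourierInt f.toFun t‖ ^ 2)|⁻¹ ≤ d⁻¹}

/-- The densities that are supersmooth with parameter `a`, for some constant `d > 0`. -/
def supersmooth (a : ℝ) : Set L2Density :=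
  {f | ∃ d : ℝ, 0 < d ∧ f ∈ supersmoothWith a d}

/-- The probability measure with a given Lebesgue density. -/
def law (g : ℝ → ℝ) : Measure ℝ :=
  volume.withDensity (fun x => ENNReal.ofReal (g x))

/-- The convolution `f_Y(y) = ∫ f_X(x) f_ε(y - x) dx`, the density of `Y = X + ε`. -/
def convDensity (fX fε : L2Density) (y : ℝ) : ℝ :=
  ∫ x, fX.toFun x * fε.toFun (y - x)

/-- The joint law of two independent samples: `Y₁, …, Yₙ` i.i.d. from `f_Y = f_X ⋆ f_ε`, and
`ε₁, …, εₘ` i.i.d. from `f_ε`. -/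
def sampleLaw (n m : ℕ) (fX fε : L2Density) : Measure ((Fin n → ℝ) × (Fin m → ℝ)) :=
  (Measure.pi fun _ : Fin n => law (convDensity fX fε)).prod
    (Measure.pi fun _ : Fin m => law fε.toFun)

/-- The `H_s`-risk `E ‖T(Y, ε) - f_X‖_s²` of an `L²(ℝ)`-valued estimator `T`. -/
def risk (n m : ℕ) (s : ℝ) (T : (Fin n → ℝ) × (Fin m → ℝ) → Lp ℂ 2 (volume : Measure ℝ))
    (fX fε : L2Density) : ℝ≥0∞ :=
  ∫⁻ z, sobolevSq s (T z - fX.toL2) ∂(sampleLaw n m fX fε)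

/-- The minimax `H_s`-risk over `f_X ∈ 𝒳` and `f_ε ∈ ℰ`: the infimum runs over all measurable
functions of the two samples with values in `L²(ℝ)`. -/
def minimaxRisk (n m : ℕ) (s : ℝ) (𝒳 ℰ : Set L2Density) : ℝ≥0∞ :=
  ⨅ (T : (Fin n → ℝ) × (Fin m → ℝ) → Lp ℂ 2 (volume : Measure ℝ)) (_ : StronglyMeasurable T),
    ⨆ (fX ∈ 𝒳) (fε ∈ ℰ), risk n m s T fX fε

end Deconvolution

end

open MeasureTheory
open scoped FourierTransform ENNReal

namespace Deconvolution

/-! The proof is a two-point argument at a frequency `k`. Closeness of the two experiments is not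
measured by a divergence: both sample laws dominate one measure of mass at least `1/2`, which
already forces an error (`ofReal_le_risk_add_risk`).

Write `X` for a Fejér density modulated so that its characteristic function has bumps of height
about `k^(-p)` at `±k`, which a small bandwidth keeps inside the Sobolev ball uniformly in `k`
(`exists_bandwidth`). Let `ν₁`, `ν₂` be probability measures whose characteristic functions stay
close to `1` and differ only near `±k` (`exists_perturbation`). The signals are `X ∗ ν₁` and `X ∗
ν₂`; their squared distance in `H_s` is at least a constant times `k^(2s-2p)` (`le_bandNorm_sq`).

Take a supersmooth density `f` and convolve it with `(1 - τ) F + τ δ₀`, where `F` is the Fejér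
density with characteristic function supported in `[-(k-1), k-1]` and `τ = exp(-c (k-1)^(2a))`. The
result is still supersmooth, and convolution with `F` erases the difference between `ν₁` and `ν₂`
(`tri_div_mul_bumps`). If `n` is the small sample, both signals get this noise, and the laws of `Y`
share a component of mass `1 - τ`. If `m` is the small sample, the noise is convolved with `ν₂` for
the first signal and with `ν₁` for the second: the laws of `Y` then coincide, and the laws of `ε`
share a component of mass `1 - τ`.

With `k^(2a)` a multiple of `log N`, `N τ ≤ 1/2`, so the shared mass `(1 - τ)^N` is at least `1/2`,
and `k^(2s-2p)` is the logarithmic rate. Doing this for `N = n` and for `N = m` gives the sum. -/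

/-! ### Characteristic functions and Fourier transforms of densities -/

instance isProbabilityMeasure_law (f : L2Density) : IsProbabilityMeasure (law f.toFun) := by
  refine ⟨?_⟩
  rw [law, withDensity_apply _ MeasurableSet.univ, Measure.restrict_univ,
    ← ofReal_integral_eq_lintegral_ofReal f.integrable (ae_of_all _ f.nonneg),
    f.integral_eq_one, ENNReal.ofReal_one]

theorem charFun_law (f : L2Density) (t : ℝ) :
    charFun (law f.toFun) t = ∫ x : ℝ, Complex.exp (t * x * Complex.I) * (f.toFun x : ℂ) := by
  rw [charFun_apply_real, law, integral_withDensity_eq_integral_toReal_smul₀]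
  · refine integral_congr_ae (ae_of_all _ fun x => ?_)
    simp only [ENNReal.toReal_ofReal (f.nonneg x), Complex.real_smul]
    ring
  · exact f.integrable.aemeasurable.ennreal_ofReal
  · exact ae_of_all _ fun x => ENNReal.ofReal_lt_top

theorem fourierInt_eq_charFun (f : L2Density) (t : ℝ) :
    fourierInt f.toFun t = ((Real.sqrt (2 * Real.pi))⁻¹ : ℝ) * charFun (law f.toFun) (-t) := by
  rw [fourierInt, charFun_law]
  congr 1
  refine integral_congr_ae (ae_of_all _ fun x => ?_)
  simp only
  congr 2
  push_cast
  ring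

/-- On `L¹ ∩ L²` the Plancherel transform is given by the Fourier integral. -/
theorem fourier_toL2_ae (f : L2Density) :
    (𝓕 f.toL2 : Lp ℂ 2 (volume : Measure ℝ)) =ᵐ[volume]
      fun u => charFun (law f.toFun) (-(2 * Real.pi * u)) := by
  have hint : Integrable (fun x => (f.toFun x : ℂ)) := f.integrable.ofReal
  have hF : (fun u => charFun (law f.toFun) (-(2 * Real.pi * u))) =
      𝓕 (fun x => (f.toFun x : ℂ)) := by
    funext u
    rw [charFun_law, Real.fourier_real_eq_integral_exp_smul]
    refine integral_congr_ae (ae_of_all _ fun x => ?_)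
    simp only [smul_eq_mul]
    congr 2
    push_cast
    ring
  rw [hF]
  have hcont : Continuous (𝓕 (fun x => (f.toFun x : ℂ))) :=
    VectorFourier.fourierIntegral_continuous Real.continuous_fourierChar
      (by exact continuous_inner) hint
  -- Both sides are compared as tempered distributions: the transform is moved onto a smooth,
  -- compactly supported test function, where the two definitions agree.
  refine ae_eq_of_integral_contDiff_smul_eq
    ((Lp.memLp _).locallyIntegrable (by norm_num)) hcont.locallyIntegrable ?_
  intro g g_smooth g_cpt
  have hg₁ : HasCompactSupport (Complex.ofRealCLM ∘ g) := g_cpt.comp_left rfl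
  have hg₂ : ContDiff ℝ (⊤ : ℕ∞) (Complex.ofRealCLM ∘ g) := by
    exact Complex.ofRealCLM.contDiff.comp g_smooth
  set G : SchwartzMap ℝ ℂ := hg₁.toSchwartzMap hg₂ with hG
  have hGx : ∀ x, G x = (g x : ℂ) := fun x => by simp [hG]
  calc ∫ x, g x • (𝓕 f.toL2 : Lp ℂ 2 (volume : Measure ℝ)) x
      = (Lp.toTemperedDistribution (𝓕 f.toL2 : Lp ℂ 2 (volume : Measure ℝ))) G := by
        rw [Lp.toTemperedDistribution_apply]
        simp [hGx]
    _ = Lp.toTemperedDistribution f.toL2 (𝓕 G) := by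
        rw [← Lp.fourier_toTemperedDistribution_eq, TemperedDistribution.fourier_apply]
    _ = ∫ x, (𝓕 (G : ℝ → ℂ)) x • (f.toFun x : ℂ) := by
        rw [Lp.toTemperedDistribution_apply]
        refine integral_congr_ae ?_
        filter_upwards [(f.memLp.ofReal (K := ℂ)).coeFn_toLp] with x hx
        rw [SchwartzMap.fourier_coe]
        congr 1
    _ = ∫ x, G x • 𝓕 (fun x => (f.toFun x : ℂ)) x := by
        have := VectorFourier.integral_fourierIntegral_smul_eq_flip (L := innerₗ ℝ)
          (μ := volume) (ν := volume) Real.continuous_fourierChar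
          (by exact continuous_inner) G.integrable hint
        rw [flip_innerₗ] at this
        exact this
    _ = ∫ x, g x • 𝓕 (fun x => (f.toFun x : ℂ)) x := by
        simp [hGx]

/-! ### The triangle function and the Fejér kernel -/

/-- The triangle function `t ↦ (1 - |t|)₊`. -/
noncomputable def tri (t : ℝ) : ℝ := max 0 (1 - |t|)

theorem tri_nonneg (t : ℝ) : 0 ≤ tri t := le_max_left _ _

theorem tri_le_one (t : ℝ) : tri t ≤ 1 := max_le zero_le_one (by linarith [abs_nonneg t])

theorem one_sub_abs_le_tri (t : ℝ) : 1 - |t| ≤ tri t := le_max_right _ _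

theorem tri_zero : tri 0 = 1 := by simp [tri]

theorem tri_neg (t : ℝ) : tri (-t) = tri t := by simp [tri]

theorem tri_eq_zero {t : ℝ} (h : 1 ≤ |t|) : tri t = 0 := max_eq_left (by linarith)

theorem tri_of_abs_le {t : ℝ} (h : |t| ≤ 1) : tri t = 1 - |t| := max_eq_right (by linarith)

theorem continuous_tri : Continuous tri := by unfold tri; fun_prop

theorem integrable_tri : Integrable tri := by
  refine continuous_tri.integrable_of_hasCompactSupport
    (HasCompactSupport.intro (isCompact_Icc (a := -1) (b := 1)) fun x hx => tri_eq_zero ?_)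
  rw [Set.mem_Icc, ← abs_le, not_le] at hx
  exact hx.le

theorem integral_one_sub_mul_exp {z : ℂ} (hz : z ≠ 0) :
    ∫ t in (0 : ℝ)..1, (1 - (t : ℂ)) * Complex.exp (z * t) =
      (Complex.exp z - 1) / z ^ 2 - 1 / z := by
  have hd : ∀ t : ℝ, HasDerivAt
      (fun t : ℝ => Complex.exp (z * t) * ((1 - (t : ℂ)) / z + 1 / z ^ 2))
      ((1 - (t : ℂ)) * Complex.exp (z * t)) t := by
    intro t
    have h1 : HasDerivAt (fun t : ℝ => (t : ℂ)) 1 t := Complex.ofRealCLM.hasDerivAt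
    have h2 := ((h1.const_mul z).cexp).mul (((h1.const_sub 1).div_const z).add_const (1 / z ^ 2))
    refine h2.congr_deriv ?_
    field_simp
    ring
  rw [intervalIntegral.integral_eq_sub_of_hasDerivAt (fun t _ => hd t)
    (by apply Continuous.intervalIntegrable; fun_prop)]
  simp
  field_simp
  ring

theorem fourier_tri_of_ne_zero {u : ℝ} (hu : u ≠ 0) :
    𝓕 (fun t => (tri t : ℂ)) u =
      (((2 - 2 * Real.cos (2 * Real.pi * u)) / (2 * Real.pi * u) ^ 2 : ℝ) : ℂ) := by
  set w : ℝ := 2 * Real.pi * u with hw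
  have hw0 : w ≠ 0 := by positivity
  set z : ℂ := -(w * Complex.I) with hz
  have hz0 : z ≠ 0 := by simp [hz, hw0]
  have h1 : 𝓕 (fun t => (tri t : ℂ)) u = ∫ t : ℝ, (tri t : ℂ) * Complex.exp (z * t) := by
    rw [Real.fourier_real_eq_integral_exp_smul]
    refine integral_congr_ae (ae_of_all _ fun t => ?_)
    simp only [smul_eq_mul]
    rw [mul_comm]
    congr 2
    rw [hz, hw]
    push_cast
    ring
  have h2 : ∫ t : ℝ, (tri t : ℂ) * Complex.exp (z * t) =
      ∫ t in (-1 : ℝ)..1, (tri t : ℂ) * Complex.exp (z * t) := by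
    rw [intervalIntegral.integral_of_le (by norm_num), ← integral_Icc_eq_integral_Ioc]
    refine (setIntegral_eq_integral_of_forall_compl_eq_zero fun x hx => ?_).symm
    rw [Set.mem_Icc, ← abs_le, not_le] at hx
    simp [tri_eq_zero hx.le]
  have hcont : Continuous fun t : ℝ => (tri t : ℂ) * Complex.exp (z * t) := by
    have := continuous_tri
    fun_prop
  have h3 : ∫ t in (0 : ℝ)..1, (tri t : ℂ) * Complex.exp (z * t) =
      (Complex.exp z - 1) / z ^ 2 - 1 / z := by
    rw [← integral_one_sub_mul_exp hz0]
    refine intervalIntegral.integral_congr fun t ht => ?_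
    rw [Set.uIcc_of_le zero_le_one] at ht
    rw [tri_of_abs_le (by rw [abs_of_nonneg ht.1]; exact ht.2), abs_of_nonneg ht.1]
    push_cast
    ring
  have h4 : ∫ t in (-1 : ℝ)..0, (tri t : ℂ) * Complex.exp (z * t) =
      (Complex.exp (-z) - 1) / (-z) ^ 2 - 1 / (-z) := by
    rw [← integral_one_sub_mul_exp (neg_ne_zero.2 hz0)]
    have := intervalIntegral.integral_comp_neg (a := 0) (b := 1)
      (f := fun t : ℝ => (tri t : ℂ) * Complex.exp (z * t))
    simp only [neg_zero] at this
    rw [← this]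
    refine intervalIntegral.integral_congr fun t ht => ?_
    rw [Set.uIcc_of_le zero_le_one] at ht
    rw [tri_neg, tri_of_abs_le (by rw [abs_of_nonneg ht.1]; exact ht.2), abs_of_nonneg ht.1]
    push_cast
    congr 2
    ring
  rw [h1, h2, ← intervalIntegral.integral_add_adjacent_intervals
    (hcont.intervalIntegrable (-1) 0) (hcont.intervalIntegrable 0 1), h3, h4]
  have hcos : Complex.exp z + Complex.exp (-z) = 2 * Complex.cos w := by
    rw [Complex.two_cos, hz]
    ring_nf
  have hz2 : z ^ 2 = -(w : ℂ) ^ 2 := by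
    rw [hz, neg_sq, mul_pow, Complex.I_sq]
    ring
  have hsum : (Complex.exp (-z) - 1) / (-z) ^ 2 - 1 / (-z) +
      ((Complex.exp z - 1) / z ^ 2 - 1 / z) =
      (Complex.exp z + Complex.exp (-z) - 2) / z ^ 2 := by
    field_simp
    ring
  rw [hsum, hcos, hz2]
  push_cast
  rw [div_neg, ← neg_div]
  ring

/-- The Fejér kernel, that is, the Fourier transform of the triangle function. -/
noncomputable def fejer (u : ℝ) : ℝ := (𝓕 (fun t => (tri t : ℂ)) u).re

theorem continuous_fourier_tri : Continuous (𝓕 (fun t => (tri t : ℂ))) :=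
  VectorFourier.fourierIntegral_continuous Real.continuous_fourierChar
    (by exact continuous_inner) integrable_tri.ofReal

theorem continuous_fejer : Continuous fejer :=
  Complex.continuous_re.comp continuous_fourier_tri

/-- The closed form shows that the transform is real off the origin; continuity and density carry
this over to the origin, where the formula degenerates. -/
theorem fourier_tri (u : ℝ) : 𝓕 (fun t => (tri t : ℂ)) u = (fejer u : ℂ) := by
  have key : Set.EqOn (𝓕 (fun t => (tri t : ℂ))) (fun u => (fejer u : ℂ)) Set.univ := by
    rw [← (dense_compl_singleton (0 : ℝ)).closure_eq]
    refine Set.EqOn.closure (fun v hv => ?_) continuous_fourier_tri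
      (Complex.continuous_ofReal.comp continuous_fejer)
    rw [fejer, fourier_tri_of_ne_zero hv, Complex.ofReal_re]
  exact key (Set.mem_univ u)

theorem fejer_of_ne_zero {u : ℝ} (hu : u ≠ 0) :
    fejer u = (2 - 2 * Real.cos (2 * Real.pi * u)) / (2 * Real.pi * u) ^ 2 := by
  rw [fejer, fourier_tri_of_ne_zero hu, Complex.ofReal_re]

theorem fejer_nonneg (u : ℝ) : 0 ≤ fejer u := by
  have hc : closure ({0}ᶜ : Set ℝ) ⊆ {u | 0 ≤ fejer u} :=
    closure_minimal (fun v hv => by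
      rw [Set.mem_ofPred_eq, fejer_of_ne_zero hv]
      have := Real.cos_le_one (2 * Real.pi * v)
      exact div_nonneg (by linarith) (sq_nonneg _))
      (isClosed_le continuous_const continuous_fejer)
  exact hc ((dense_compl_singleton (0 : ℝ)) u)

theorem exists_fejer_le : ∃ M : ℝ, 0 < M ∧ ∀ u, fejer u ≤ M := by
  refine ⟨(∫ t, ‖(tri t : ℂ)‖) + 1, by positivity, fun u => ?_⟩
  calc fejer u ≤ ‖𝓕 (fun t => (tri t : ℂ)) u‖ := Complex.re_le_norm _
    _ ≤ ∫ t, ‖(tri t : ℂ)‖ := VectorFourier.norm_fourierIntegral_le_integral_norm _ _ _ _ _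
    _ ≤ _ := by linarith

/-- The kernel is bounded and at most `1 / u ^ 2`, hence dominated by a multiple of `1 / (1 + u ^
2)`. Integrability is what makes Fourier inversion available. -/
theorem integrable_fejer : Integrable fejer := by
  obtain ⟨M, hM, hle⟩ := exists_fejer_le
  refine (integrable_inv_one_add_sq.const_mul (2 * M + 2)).mono'
    continuous_fejer.aestronglyMeasurable (ae_of_all _ fun u => ?_)
  rw [Real.norm_of_nonneg (fejer_nonneg u), ← div_eq_mul_inv, le_div_iff₀ (by positivity)]
  rcases le_or_gt (u ^ 2) 1 with h | h
  · nlinarith [hle u, fejer_nonneg u]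
  · have hu : u ≠ 0 := by rintro rfl; norm_num at h
    have h1 : fejer u * u ^ 2 ≤ 1 := by
      rw [fejer_of_ne_zero hu, div_mul_eq_mul_div, div_le_one (by positivity)]
      have := Real.neg_one_le_cos (2 * Real.pi * u)
      have hpi := Real.pi_gt_three
      have : 4 ≤ (2 * Real.pi) ^ 2 := by nlinarith
      rw [mul_pow]
      nlinarith [sq_nonneg u]
    nlinarith [fejer_nonneg u]

theorem integral_exp_mul_fejer (t : ℝ) :
    ∫ v : ℝ, Complex.exp ((2 * Real.pi * v * t : ℝ) * Complex.I) * (fejer v : ℂ) = tri t := by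
  have hF : 𝓕 (fun t => (tri t : ℂ)) = fun u => (fejer u : ℂ) := funext fourier_tri
  have h := congrFun (Continuous.fourierInv_fourier_eq (f := fun t => (tri t : ℂ))
    (Complex.continuous_ofReal.comp continuous_tri) integrable_tri.ofReal
    (by rw [hF]; exact integrable_fejer.ofReal)) t
  rw [hF, Real.fourierInv_eq'] at h
  rw [← h]
  refine integral_congr_ae (ae_of_all _ fun v => ?_)
  simp only [smul_eq_mul]
  congr 3
  simp
  ring

/-! ### Fejér densities and their modulations -/

/-- The Fejér density with characteristic function `tri (t / b)`. -/
noncomputable def fejerDensity (b x : ℝ) : ℝ := b / (2 * Real.pi) * fejer (b / (2 * Real.pi) * x)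

theorem fejerDensity_nonneg {b : ℝ} (hb : 0 < b) (x : ℝ) : 0 ≤ fejerDensity b x :=
  mul_nonneg (by positivity) (fejer_nonneg _)

theorem continuous_fejerDensity (b : ℝ) : Continuous (fejerDensity b) := by
  have := continuous_fejer
  unfold fejerDensity
  fun_prop

theorem integrable_fejerDensity {b : ℝ} (hb : 0 < b) : Integrable (fejerDensity b) :=
  (integrable_fejer.comp_mul_left' (by positivity)).const_mul _

theorem exists_fejerDensity_le : ∃ M : ℝ, 0 < M ∧ ∀ b x, 0 < b → fejerDensity b x ≤ M * b := by
  obtain ⟨M, hM, hle⟩ := exists_fejer_le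
  refine ⟨M / (2 * Real.pi), by positivity, fun b x hb => ?_⟩
  calc fejerDensity b x ≤ b / (2 * Real.pi) * M :=
        mul_le_mul_of_nonneg_left (hle _) (by positivity)
    _ = _ := by ring

theorem integral_exp_mul_fejerDensity {b : ℝ} (hb : 0 < b) (t : ℝ) :
    ∫ x : ℝ, Complex.exp (t * x * Complex.I) * (fejerDensity b x : ℂ) = tri (t / b) := by
  have hc : 0 < b / (2 * Real.pi) := by positivity
  rw [← integral_exp_mul_fejer]
  have := Measure.integral_comp_mul_left
    (fun v : ℝ => Complex.exp ((2 * Real.pi * v * (t / b) : ℝ) * Complex.I) * (fejer v : ℂ))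
    (b / (2 * Real.pi))
  rw [abs_of_pos (inv_pos.2 hc)] at this
  rw [← one_smul ℝ (∫ v : ℝ, Complex.exp ((2 * Real.pi * v * (t / b) : ℝ) * Complex.I) *
    (fejer v : ℂ)), ← mul_inv_cancel₀ hc.ne', mul_smul, ← this, ← integral_smul]
  refine integral_congr_ae (ae_of_all _ fun x => ?_)
  simp only [fejerDensity, Complex.real_smul]
  have : (2 * Real.pi * (b / (2 * Real.pi) * x) * (t / b) : ℝ) = t * x := by
    field_simp
  rw [this]
  push_cast
  ring

/-- A bounded integrable density, as an `L2Density`. -/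
theorem exists_L2Density_of_bounded {f : ℝ → ℝ} (h0 : ∀ x, 0 ≤ f x) (hi : Integrable f)
    (h1 : ∫ x, f x = 1) {M : ℝ} (hM : ∀ x, f x ≤ M) : ∃ X : L2Density, X.toFun = f := by
  refine ⟨⟨f, h0, hi, h1, ?_⟩, rfl⟩
  rw [memLp_two_iff_integrable_sq hi.aestronglyMeasurable]
  simp_rw [pow_two]
  exact hi.bdd_mul hi.aestronglyMeasurable
    (ae_of_all _ fun x => by rw [Real.norm_of_nonneg (h0 x)]; exact hM x)

/-- Multiplying by `1 + κ cos (k x)` adds copies of the spectrum shifted to `±k`. The condition `|κ|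
≤ 1` keeps the function nonnegative, and `b ≤ k` makes the shifted copies vanish at `0`, so the
total mass stays `1`. -/
theorem exists_modulated_fejer {b k κ : ℝ} (hb : 0 < b) (hk : b ≤ k) (hκ : |κ| ≤ 1) :
    ∃ X : L2Density, ∀ t, charFun (law X.toFun) t =
      ((tri (t / b) + κ / 2 * (tri ((t - k) / b) + tri ((t + k) / b)) : ℝ) : ℂ) := by
  set f : ℝ → ℝ := fun x => fejerDensity b x * (1 + κ * Real.cos (k * x)) with hf
  have hmod : ∀ x, |κ * Real.cos (k * x)| ≤ 1 := fun x => by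
    rw [abs_mul]
    exact mul_le_one₀ hκ (abs_nonneg _) (Real.abs_cos_le_one _)
  have hi : Integrable f := by
    rw [hf]
    simp_rw [mul_comm (fejerDensity b _)]
    refine (integrable_fejerDensity hb).bdd_mul (c := 2)
      (by apply Continuous.aestronglyMeasurable; fun_prop) (ae_of_all _ fun x => ?_)
    rw [Real.norm_eq_abs]
    have := abs_le.1 (hmod x)
    rw [abs_le]
    constructor <;> linarith
  have hexp : ∀ s : ℝ, Integrable fun x : ℝ =>
      Complex.exp (s * x * Complex.I) * (fejerDensity b x : ℂ) := fun s => by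
    refine (integrable_fejerDensity hb).ofReal.bdd_mul (c := 1)
      (by apply Continuous.aestronglyMeasurable; fun_prop) (ae_of_all _ fun x => ?_)
    rw [← Complex.ofReal_mul, Complex.norm_exp_ofReal_mul_I]
  have hchar : ∀ t : ℝ, ∫ x : ℝ, Complex.exp (t * x * Complex.I) * (f x : ℂ) =
      ((tri (t / b) + κ / 2 * (tri ((t - k) / b) + tri ((t + k) / b)) : ℝ) : ℂ) := by
    intro t
    push_cast
    rw [← integral_exp_mul_fejerDensity hb, ← integral_exp_mul_fejerDensity hb,
      ← integral_exp_mul_fejerDensity hb, ← integral_add (hexp _) (hexp _),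
      ← integral_const_mul]
    have hsum : Integrable fun x : ℝ => (κ : ℂ) / 2 *
        (Complex.exp ((t - k : ℝ) * x * Complex.I) * (fejerDensity b x : ℂ) +
          Complex.exp ((t + k : ℝ) * x * Complex.I) * (fejerDensity b x : ℂ)) :=
      ((hexp _).add (hexp _)).const_mul _
    rw [← integral_add (hexp _) hsum]
    refine integral_congr_ae (ae_of_all _ fun x => ?_)
    simp only [hf]
    push_cast
    rw [Complex.cos]
    have e1 : Complex.exp ((t - k) * x * Complex.I) =
        Complex.exp (t * x * Complex.I) * Complex.exp (-(k * x) * Complex.I) := by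
      rw [← Complex.exp_add]; ring_nf
    have e2 : Complex.exp ((t + k) * x * Complex.I) =
        Complex.exp (t * x * Complex.I) * Complex.exp (k * x * Complex.I) := by
      rw [← Complex.exp_add]; ring_nf
    rw [e1, e2]
    ring
  obtain ⟨M, hM, hle⟩ := exists_fejerDensity_le
  have h1 : ∫ x, f x = 1 := by
    have h := hchar 0
    have e1 : tri ((0 - k) / b) = 0 := tri_eq_zero (by
      rw [abs_div, zero_sub, abs_neg, abs_of_pos hb, abs_of_pos (hb.trans_le hk)]
      exact (one_le_div hb).2 hk)
    have e2 : tri ((0 + k) / b) = 0 := tri_eq_zero (by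
      rw [abs_div, zero_add, abs_of_pos hb, abs_of_pos (hb.trans_le hk)]
      exact (one_le_div hb).2 hk)
    rw [e1, e2, zero_div, tri_zero] at h
    simp only [Complex.ofReal_zero, zero_mul, Complex.exp_zero, one_mul] at h
    rw [integral_complex_ofReal] at h
    simpa using h
  obtain ⟨X, hX⟩ := exists_L2Density_of_bounded (f := f) (M := M * b * 2)
    (fun x => mul_nonneg (fejerDensity_nonneg hb x) (by linarith [abs_le.1 (hmod x)])) hi h1
    (fun x => mul_le_mul (hle b x hb) (by linarith [(abs_le.1 (hmod x)).2])
      (by linarith [(abs_le.1 (hmod x)).1]) (by positivity))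
  refine ⟨X, fun t => ?_⟩
  rw [charFun_law, hX, hchar]

theorem exists_fejer_density {b : ℝ} (hb : 0 < b) :
    ∃ X : L2Density, ∀ t, charFun (law X.toFun) t = (tri (t / b) : ℂ) := by
  obtain ⟨X, hX⟩ := exists_modulated_fejer (κ := 0) hb le_rfl (by simp)
  exact ⟨X, fun t => by rw [hX]; simp⟩

/-! ### Convolutions, their densities and the sample laws -/

theorem exists_law_eq_withDensity {h : ℝ → ℝ≥0∞} (hm : Measurable h) (h1 : ∫⁻ x, h x = 1)
    (h2 : ∫⁻ x, h x ^ 2 ≠ ⊤) : ∃ g : L2Density, law g.toFun = volume.withDensity h := by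
  have hfin : ∀ᵐ x, h x < ⊤ := ae_lt_top hm (by rw [h1]; exact ENNReal.one_ne_top)
  refine ⟨⟨fun x => (h x).toReal, fun x => ENNReal.toReal_nonneg, ?_, ?_, ?_⟩, ?_⟩
  · exact integrable_toReal_of_lintegral_ne_top hm.aemeasurable
      (by rw [h1]; exact ENNReal.one_ne_top)
  · rw [integral_toReal hm.aemeasurable hfin, h1, ENNReal.toReal_one]
  · rw [memLp_two_iff_integrable_sq hm.ennreal_toReal.aestronglyMeasurable]
    simp_rw [← ENNReal.toReal_pow]
    exact integrable_toReal_of_lintegral_ne_top (hm.pow_const 2).aemeasurable h2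
  · refine withDensity_congr_ae ?_
    filter_upwards [hfin] with x hx
    exact ENNReal.ofReal_toReal hx.ne

theorem sq_lintegral_le {ν : Measure ℝ} [IsProbabilityMeasure ν] {g : ℝ → ℝ≥0∞}
    (hg : Measurable g) : (∫⁻ y, g y ∂ν) ^ 2 ≤ ∫⁻ y, g y ^ 2 ∂ν := by
  have h := ENNReal.lintegral_mul_le_Lp_mul_Lq ν Real.HolderConjugate.two_two
    hg.aemeasurable (aemeasurable_const (b := (1 : ℝ≥0∞)))
  simp only [Pi.mul_apply, mul_one, ENNReal.one_rpow, lintegral_const, measure_univ] at h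
  calc (∫⁻ y, g y ∂ν) ^ 2 ≤ ((∫⁻ y, g y ^ (2 : ℝ) ∂ν) ^ (1 / 2 : ℝ)) ^ 2 := by gcongr
    _ = ∫⁻ y, g y ^ 2 ∂ν := by
      rw [← ENNReal.rpow_natCast, ← ENNReal.rpow_mul]
      norm_num

/-- The convolution of a density in `L²` with a probability measure has a density in `L²`. -/
theorem exists_law_eq_conv (f : L2Density) (ν : Measure ℝ) [IsProbabilityMeasure ν] :
    ∃ g : L2Density, law g.toFun = law f.toFun ∗ ν := by
  -- A measurable representative is needed for Tonelli's theorem in the variables `(z, y)`.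
  have haem : AEMeasurable (fun x => ENNReal.ofReal (f.toFun x)) volume :=
    f.integrable.aemeasurable.ennreal_ofReal
  set φ : ℝ → ℝ≥0∞ := haem.mk with hφ
  have hφm : Measurable φ := haem.measurable_mk
  have hlaw : law f.toFun = volume.withDensity φ := withDensity_congr_ae haem.ae_eq_mk
  have hφ1 : ∫⁻ x, φ x = 1 := by
    have := measure_univ (μ := law f.toFun)
    rwa [hlaw, withDensity_apply _ MeasurableSet.univ, Measure.restrict_univ] at this
  have hφ2 : ∫⁻ x, φ x ^ 2 ≠ ⊤ := by
    have h := (memLp_two_iff_integrable_sq f.memLp.1).1 f.memLp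
    have h' := h.lintegral_lt_top
    rw [lintegral_congr_ae (g := fun x => φ x ^ 2)] at h'
    · exact h'.ne
    · filter_upwards [haem.ae_eq_mk] with x hx
      rw [ENNReal.ofReal_pow (f.nonneg x), hx]
  have hm2 : Measurable fun p : ℝ × ℝ => φ (p.1 - p.2) :=
    hφm.comp (measurable_fst.sub measurable_snd)
  set h : ℝ → ℝ≥0∞ := fun z => ∫⁻ y, φ (z - y) ∂ν with hh
  have hhm : Measurable h := hm2.lintegral_prod_right'
  have key : law f.toFun ∗ ν = volume.withDensity h := by
    refine Measure.ext_of_lintegral _ fun ψ hψ => ?_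
    rw [Measure.lintegral_conv hψ, hlaw, lintegral_withDensity_eq_lintegral_mul _ hφm
      (by fun_prop), lintegral_withDensity_eq_lintegral_mul _ hhm hψ]
    simp only [Pi.mul_apply]
    calc ∫⁻ x, φ x * ∫⁻ y, ψ (x + y) ∂ν = ∫⁻ x, ∫⁻ y, φ x * ψ (x + y) ∂ν := by
          refine lintegral_congr fun x => (lintegral_const_mul _ (by fun_prop)).symm
      _ = ∫⁻ y, (∫⁻ x, φ x * ψ (x + y)) ∂ν :=
          lintegral_lintegral_swap (Measurable.aemeasurable
            ((hφm.comp measurable_fst).mul (hψ.comp (measurable_fst.add measurable_snd))))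
      _ = ∫⁻ y, (∫⁻ z, φ (z - y) * ψ z) ∂ν := by
          refine lintegral_congr fun y => ?_
          rw [← lintegral_add_right_eq_self (fun z => φ (z - y) * ψ z) y]
          simp
      _ = ∫⁻ z, ∫⁻ y, φ (z - y) * ψ z ∂ν := by
          refine (lintegral_lintegral_swap (Measurable.aemeasurable ?_))
          exact (hφm.comp (measurable_snd.sub measurable_fst)).mul (hψ.comp measurable_snd)
      _ = ∫⁻ z, h z * ψ z := by
          refine lintegral_congr fun z => lintegral_mul_const _ (by fun_prop)
  obtain ⟨g, hg⟩ := exists_law_eq_withDensity hhm (by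
    have := measure_univ (μ := law f.toFun ∗ ν)
    rwa [key, withDensity_apply _ MeasurableSet.univ, Measure.restrict_univ] at this) (by
    refine ne_top_of_le_ne_top hφ2 ?_
    -- Cauchy–Schwarz under `ν` and translation invariance: convolving with a probability measure
    -- does not increase the `L²` norm.
    calc ∫⁻ z, h z ^ 2 ≤ ∫⁻ z, ∫⁻ y, φ (z - y) ^ 2 ∂ν :=
          lintegral_mono fun z => sq_lintegral_le (by fun_prop)
      _ = ∫⁻ y, (∫⁻ z, φ (z - y) ^ 2) ∂ν :=
          lintegral_lintegral_swap (Measurable.aemeasurable (hm2.pow_const 2))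
      _ = ∫⁻ y, (∫⁻ z, φ z ^ 2) ∂ν := by
          refine lintegral_congr fun y => ?_
          exact lintegral_sub_right_eq_self (fun z => φ z ^ 2) y
      _ = ∫⁻ z, φ z ^ 2 := by simp)
  exact ⟨g, hg.trans key.symm⟩

theorem law_convDensity (fX fε : L2Density) :
    law (convDensity fX fε) = law fX.toFun ∗ law fε.toFun := by
  have hX : AEMeasurable (fun x => ENNReal.ofReal (fX.toFun x)) volume :=
    fX.integrable.aemeasurable.ennreal_ofReal
  have hε : AEMeasurable (fun x => ENNReal.ofReal (fε.toFun x)) volume :=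
    fε.integrable.aemeasurable.ennreal_ofReal
  have key : law fX.toFun ∗ law fε.toFun = volume.withDensity _ :=
    conv_withDensity_eq_mlconvolution₀ hX hε
  have hfin := measure_univ (μ := law fX.toFun ∗ law fε.toFun)
  rw [key, withDensity_apply _ MeasurableSet.univ, Measure.restrict_univ] at hfin
  rw [key, law]
  refine withDensity_congr_ae ?_
  -- The Bochner integral in `convDensity` takes the default value `0` where the integrand is not
  -- integrable; finite total mass confines this to a null set.
  filter_upwards [ae_lt_top' (aemeasurable_lconvolution hX hε)
    (by rw [hfin]; exact ENNReal.one_ne_top)] with y hy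
  rw [lconvolution_def] at hy ⊢
  have he : ∀ x, ENNReal.ofReal (fX.toFun x) * ENNReal.ofReal (fε.toFun (-x + y)) =
      ENNReal.ofReal (fX.toFun x * fε.toFun (y - x)) := fun x => by
    rw [← ENNReal.ofReal_mul (fX.nonneg x), neg_add_eq_sub]
  simp_rw [he] at hy ⊢
  rw [convDensity, integral_eq_lintegral_of_nonneg_ae
    (ae_of_all _ fun x => mul_nonneg (fX.nonneg x) (fε.nonneg _))
    (fX.integrable.aestronglyMeasurable.mul (fε.integrable.comp_sub_left y).aestronglyMeasurable),
    ENNReal.ofReal_toReal hy.ne]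

theorem sampleLaw_eq (n m : ℕ) (fX fε : L2Density) :
    sampleLaw n m fX fε =
      (Measure.pi fun _ : Fin n => law fX.toFun ∗ law fε.toFun).prod
        (Measure.pi fun _ : Fin m => law fε.toFun) := by
  rw [sampleLaw, law_convDensity]

/-- The product outer measure is the largest one bounded on boxes by the product of the side masses,
so boxes suffice. -/
theorem pi_mono_measure {ι : Type*} [Fintype ι] {μ ν : ι → Measure ℝ}
    [∀ i, SigmaFinite (μ i)] (h : ∀ i, μ i ≤ ν i) : Measure.pi μ ≤ Measure.pi ν := by
  have hout : (Measure.pi μ).toOuterMeasure ≤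
      OuterMeasure.pi fun i => (ν i).toOuterMeasure := by
    refine OuterMeasure.le_pi.2 fun s _ => ?_
    exact (Measure.pi_pi μ s).trans_le (Finset.prod_le_prod' fun i _ => h i (s i))
  refine Measure.le_iff.2 fun s hs => ?_
  rw [Measure.pi_def ν, toMeasure_apply _ _ hs]
  exact hout s

/-! ### Sobolev norms and frequency bands -/

theorem lintegral_comp_div_two_pi (F : ℝ → ℝ≥0∞) :
    ∫⁻ t, F (t / (2 * Real.pi)) = ENNReal.ofReal (2 * Real.pi) * ∫⁻ u, F u := by
  have hpi : 0 < 2 * Real.pi := by positivity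
  have hne : (2 * Real.pi)⁻¹ ≠ 0 := by positivity
  have h := (measurableEmbedding_mulRight₀ hne).lintegral_map (μ := volume) F
  rw [Real.map_volume_mul_right hne, lintegral_smul_measure, inv_inv, abs_of_pos hpi,
    smul_eq_mul] at h
  simpa [div_eq_mul_inv] using h.symm

theorem norm_fourierL2_sq (g : Lp ℂ 2 (volume : Measure ℝ)) (t : ℝ) :
    ‖fourierL2 g t‖ ^ 2 = (2 * Real.pi)⁻¹ *
      ‖(𝓕 g : Lp ℂ 2 (volume : Measure ℝ)) (t / (2 * Real.pi))‖ ^ 2 := by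
  rw [fourierL2, norm_mul, mul_pow, Complex.norm_real, Real.norm_of_nonneg (by positivity),
    inv_pow, Real.sq_sqrt (by positivity)]

theorem sobolevSq_eq (s : ℝ) (g : Lp ℂ 2 (volume : Measure ℝ)) :
    sobolevSq s g = ∫⁻ u, ENNReal.ofReal ((1 + (2 * Real.pi * u) ^ 2) ^ s *
      ‖(𝓕 g : Lp ℂ 2 (volume : Measure ℝ)) u‖ ^ 2) := by
  have hpi : 0 < 2 * Real.pi := by positivity
  have h := lintegral_comp_div_two_pi fun u => ENNReal.ofReal
    ((2 * Real.pi)⁻¹ * ((1 + (2 * Real.pi * u) ^ 2) ^ s *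
      ‖(𝓕 g : Lp ℂ 2 (volume : Measure ℝ)) u‖ ^ 2))
  rw [← lintegral_const_mul' _ _ ENNReal.ofReal_ne_top] at h
  rw [sobolevSq]
  convert h using 1
  · refine lintegral_congr fun t => ?_
    rw [norm_fourierL2_sq, mul_div_cancel₀ _ hpi.ne']
    ring_nf
  · refine lintegral_congr fun u => ?_
    rw [← ENNReal.ofReal_mul hpi.le, mul_inv_cancel_left₀ hpi.ne']

theorem sobolevSq_toL2 (s : ℝ) (f : L2Density) :
    sobolevSq s f.toL2 = ∫⁻ u, ENNReal.ofReal ((1 + (2 * Real.pi * u) ^ 2) ^ s *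
      ‖charFun (law f.toFun) (-(2 * Real.pi * u))‖ ^ 2) := by
  rw [sobolevSq_eq]
  refine lintegral_congr_ae ?_
  filter_upwards [fourier_toL2_ae f] with u hu
  rw [hu]

/-- The `L²(S)`-norm of the Plancherel transform. -/
noncomputable def bandNorm (S : Set ℝ) (g : Lp ℂ 2 (volume : Measure ℝ)) : ℝ :=
  ‖LpToLpRestrictCLM ℝ ℂ ℂ volume 2 S (𝓕 g : Lp ℂ 2 (volume : Measure ℝ))‖

theorem bandNorm_nonneg (S : Set ℝ) (g : Lp ℂ 2 (volume : Measure ℝ)) : 0 ≤ bandNorm S g :=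
  norm_nonneg _

/-- Continuity on `L²` gives measurability of the loss of a strongly measurable estimator. This and
finiteness are why the band norm replaces the possibly infinite Sobolev norm in the two-point bound.
-/
theorem continuous_bandNorm (S : Set ℝ) : Continuous (bandNorm S) :=
  ((LpToLpRestrictCLM ℝ ℂ ℂ volume 2 S).continuous.comp
    (Lp.fourierTransformₗᵢ ℝ ℂ).continuous).norm

theorem bandNorm_sub_le (S : Set ℝ) (g f₁ f₂ : Lp ℂ 2 (volume : Measure ℝ)) :
    bandNorm S (f₁ - f₂) ≤ bandNorm S (g - f₁) + bandNorm S (g - f₂) := by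
  have h : f₁ - f₂ = (g - f₂) - (g - f₁) := by abel
  have hF : (𝓕 ((g - f₂) - (g - f₁)) : Lp ℂ 2 (volume : Measure ℝ)) =
      𝓕 (g - f₂) - 𝓕 (g - f₁) := map_sub (Lp.fourierTransformₗᵢ ℝ ℂ) _ _
  rw [h, bandNorm, hF, map_sub, add_comm]
  exact norm_sub_le _ _

theorem ofReal_bandNorm_sq (S : Set ℝ) (g : Lp ℂ 2 (volume : Measure ℝ)) :
    ENNReal.ofReal (bandNorm S g ^ 2) =
      ∫⁻ u in S, ENNReal.ofReal (‖(𝓕 g : Lp ℂ 2 (volume : Measure ℝ)) u‖ ^ 2) := by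
  have h := LpToLpRestrictCLM_coeFn ℂ S (𝓕 g : Lp ℂ 2 (volume : Measure ℝ))
  rw [bandNorm, Lp.norm_def, ← ENNReal.toReal_pow, ENNReal.ofReal_toReal
    (ENNReal.pow_ne_top (Lp.eLpNorm_ne_top _)), eLpNorm_congr_ae h,
    eLpNorm_eq_lintegral_rpow_enorm_toReal (by norm_num) (by norm_num), ← ENNReal.rpow_natCast,
    ← ENNReal.rpow_mul]
  norm_num

theorem mul_bandNorm_sq_le_sobolevSq {s W : ℝ} {S : Set ℝ} (hS : MeasurableSet S) (hW : 0 ≤ W)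
    (hSW : ∀ u ∈ S, W ≤ (1 + (2 * Real.pi * u) ^ 2) ^ s) (g : Lp ℂ 2 (volume : Measure ℝ)) :
    ENNReal.ofReal (W * bandNorm S g ^ 2) ≤ sobolevSq s g := by
  rw [ENNReal.ofReal_mul hW, ofReal_bandNorm_sq, sobolevSq_eq,
    ← lintegral_const_mul' _ _ ENNReal.ofReal_ne_top]
  refine le_trans (setLIntegral_mono' hS fun u hu => ?_) (setLIntegral_le_lintegral S _)
  rw [← ENNReal.ofReal_mul hW]
  exact ENNReal.ofReal_le_ofReal (mul_le_mul_of_nonneg_right (hSW u hu) (sq_nonneg _))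

/-! ### The two-point reduction -/

/-- Le Cam's two-point bound: the two samples share the component `Γ`, of mass at least `1/2`. -/
theorem ofReal_le_risk_add_risk {n m : ℕ} {s W : ℝ} {S : Set ℝ} (hS : MeasurableSet S)
    (hW : 0 ≤ W) (hSW : ∀ u ∈ S, W ≤ (1 + (2 * Real.pi * u) ^ 2) ^ s)
    {f₁ f₂ ε₁ ε₂ : L2Density} {Γ : Measure ((Fin n → ℝ) × (Fin m → ℝ))}
    (h₁ : Γ ≤ sampleLaw n m f₁ ε₁) (h₂ : Γ ≤ sampleLaw n m f₂ ε₂)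
    (hΓ : ENNReal.ofReal (1 / 2) ≤ Γ Set.univ)
    {T : (Fin n → ℝ) × (Fin m → ℝ) → Lp ℂ 2 (volume : Measure ℝ)} (hT : StronglyMeasurable T) :
    ENNReal.ofReal (W * bandNorm S (f₁.toL2 - f₂.toL2) ^ 2 / 4) ≤
      risk n m s T f₁ ε₁ + risk n m s T f₂ ε₂ := by
  have hmeas : ∀ f : Lp ℂ 2 (volume : Measure ℝ),
      Measurable fun z => ENNReal.ofReal (W * bandNorm S (T z - f) ^ 2) := fun f => by
    have : Measurable fun z => bandNorm S (T z - f) :=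
      ((continuous_bandNorm S).comp_stronglyMeasurable
        (hT.sub stronglyMeasurable_const)).measurable
    exact ((this.pow_const 2).const_mul W).ennreal_ofReal
  have hrisk : ∀ f ε : L2Density, Γ ≤ sampleLaw n m f ε →
      ∫⁻ z, ENNReal.ofReal (W * bandNorm S (T z - f.toL2) ^ 2) ∂Γ ≤ risk n m s T f ε :=
    fun f ε h => lintegral_mono' h fun z => mul_bandNorm_sq_le_sobolevSq hS hW hSW _
  refine le_trans ?_ (add_le_add (hrisk f₁ ε₁ h₁) (hrisk f₂ ε₂ h₂))
  rw [← lintegral_add_left (hmeas _)]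
  calc ENNReal.ofReal (W * bandNorm S (f₁.toL2 - f₂.toL2) ^ 2 / 4)
      = ENNReal.ofReal (W * bandNorm S (f₁.toL2 - f₂.toL2) ^ 2 / 2) *
          ENNReal.ofReal (1 / 2) := by
        rw [← ENNReal.ofReal_mul (by positivity)]
        ring_nf
    _ ≤ ENNReal.ofReal (W * bandNorm S (f₁.toL2 - f₂.toL2) ^ 2 / 2) * Γ Set.univ := by gcongr
    _ = ∫⁻ _, ENNReal.ofReal (W * bandNorm S (f₁.toL2 - f₂.toL2) ^ 2 / 2) ∂Γ :=
        (lintegral_const _).symm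
    _ ≤ _ := by
        refine lintegral_mono fun z => ?_
        rw [← ENNReal.ofReal_add (by positivity) (by positivity)]
        refine ENNReal.ofReal_le_ofReal ?_
        have h := bandNorm_sub_le S (T z) f₁.toL2 f₂.toL2
        have h0 := bandNorm_nonneg S (f₁.toL2 - f₂.toL2)
        have hsq : bandNorm S (f₁.toL2 - f₂.toL2) ^ 2 / 2 ≤
            bandNorm S (T z - f₁.toL2) ^ 2 + bandNorm S (T z - f₂.toL2) ^ 2 := by
          have := pow_le_pow_left₀ h0 h 2
          nlinarith [sq_nonneg (bandNorm S (T z - f₁.toL2) - bandNorm S (T z - f₂.toL2))]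
        calc _ = W * (bandNorm S (f₁.toL2 - f₂.toL2) ^ 2 / 2) := by ring
          _ ≤ W * _ := mul_le_mul_of_nonneg_left hsq hW
          _ = _ := by ring

theorem ofReal_le_minimaxRisk {n m : ℕ} {s W : ℝ} {S : Set ℝ} (hS : MeasurableSet S)
    (hW : 0 ≤ W) (hSW : ∀ u ∈ S, W ≤ (1 + (2 * Real.pi * u) ^ 2) ^ s)
    {𝒳 ℰ : Set L2Density} {f₁ f₂ ε₁ ε₂ : L2Density} (hf₁ : f₁ ∈ 𝒳) (hf₂ : f₂ ∈ 𝒳)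
    (hε₁ : ε₁ ∈ ℰ) (hε₂ : ε₂ ∈ ℰ) {Γ : Measure ((Fin n → ℝ) × (Fin m → ℝ))}
    (h₁ : Γ ≤ sampleLaw n m f₁ ε₁) (h₂ : Γ ≤ sampleLaw n m f₂ ε₂)
    (hΓ : ENNReal.ofReal (1 / 2) ≤ Γ Set.univ) :
    ENNReal.ofReal (W * bandNorm S (f₁.toL2 - f₂.toL2) ^ 2 / 8) ≤ minimaxRisk n m s 𝒳 ℰ := by
  refine le_iInf₂ fun T hT => ?_
  have h := ofReal_le_risk_add_risk hS hW hSW h₁ h₂ hΓ hT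
  set R := ⨆ (fX ∈ 𝒳) (fε ∈ ℰ), risk n m s T fX fε
  have hle : ∀ f ∈ 𝒳, ∀ ε ∈ ℰ, risk n m s T f ε ≤ R := fun f hf ε hε =>
    le_trans (le_iSup₂ (f := fun ε _ => risk n m s T f ε) ε hε)
      (le_iSup₂ (f := fun f _ => ⨆ ε ∈ ℰ, risk n m s T f ε) f hf)
  have h2 := h.trans (add_le_add (hle _ hf₁ _ hε₁) (hle _ hf₂ _ hε₂))
  rw [← two_mul] at h2
  have h3 : ENNReal.ofReal (W * bandNorm S (f₁.toL2 - f₂.toL2) ^ 2 / 4) =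
      2 * ENNReal.ofReal (W * bandNorm S (f₁.toL2 - f₂.toL2) ^ 2 / 8) := by
    rw [two_mul, ← ENNReal.ofReal_add (by positivity) (by positivity)]
    ring_nf
  rw [h3] at h2
  exact (ENNReal.mul_le_mul_iff_right (by norm_num) (by norm_num)).1 h2

/-! ### Supersmoothness in terms of the characteristic function -/

theorem log_two_pi_pos : 0 < Real.log (2 * Real.pi) :=
  Real.log_pos (by linarith [Real.pi_gt_three])

theorem one_le_one_add_sq_rpow {a : ℝ} (ha : 0 ≤ a) (t : ℝ) : 1 ≤ (1 + t ^ 2) ^ a :=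
  Real.one_le_rpow (by nlinarith [sq_nonneg t]) ha

theorem sq_rpow_le_one_add_sq_rpow {a : ℝ} (ha : 0 ≤ a) (t : ℝ) :
    (t ^ 2) ^ a ≤ (1 + t ^ 2) ^ a :=
  Real.rpow_le_rpow (sq_nonneg t) (by linarith) ha

theorem log_norm_fourierInt_sq (f : L2Density) {t : ℝ} (h : charFun (law f.toFun) (-t) ≠ 0) :
    Real.log (‖fourierInt f.toFun t‖ ^ 2) =
      -(Real.log (2 * Real.pi) - 2 * Real.log ‖charFun (law f.toFun) (-t)‖) := by
  have hpi : 0 < 2 * Real.pi := by positivity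
  rw [fourierInt_eq_charFun, norm_mul, mul_pow, Complex.norm_real,
    Real.norm_of_nonneg (by positivity), inv_pow, Real.sq_sqrt hpi.le,
    Real.log_mul (by positivity) (by positivity), Real.log_inv, Real.log_pow]
  push_cast
  ring

theorem log_two_pi_le (f : L2Density) (t : ℝ) :
    Real.log (2 * Real.pi) ≤
      Real.log (2 * Real.pi) - 2 * Real.log ‖charFun (law f.toFun) t‖ := by
  have := Real.log_nonpos (norm_nonneg _) (norm_charFun_le_one (μ := law f.toFun) (t := t))
  linarith

/-- Since a characteristic function is at most `1` in modulus and `2π > 1`, the logarithm in the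
definition is negative wherever the characteristic function is nonzero, so the absolute value only
flips its sign. -/
theorem mem_supersmoothWith_iff {a d : ℝ} (hd : 0 < d) (f : L2Density) :
    f ∈ supersmoothWith a d ↔ ∀ t, charFun (law f.toFun) t ≠ 0 ∧
      d * (Real.log (2 * Real.pi) - 2 * Real.log ‖charFun (law f.toFun) t‖) ≤
        (1 + t ^ 2) ^ a ∧
      d * (1 + t ^ 2) ^ a ≤
        Real.log (2 * Real.pi) - 2 * Real.log ‖charFun (law f.toFun) t‖ := by
  have key : ∀ t, charFun (law f.toFun) (-t) ≠ 0 →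
      ((d ≤ (1 + t ^ 2) ^ a * |Real.log (‖fourierInt f.toFun t‖ ^ 2)|⁻¹ ∧
        (1 + t ^ 2) ^ a * |Real.log (‖fourierInt f.toFun t‖ ^ 2)|⁻¹ ≤ d⁻¹) ↔
      (d * (Real.log (2 * Real.pi) - 2 * Real.log ‖charFun (law f.toFun) (-t)‖) ≤
        (1 + t ^ 2) ^ a ∧
      d * (1 + t ^ 2) ^ a ≤
        Real.log (2 * Real.pi) - 2 * Real.log ‖charFun (law f.toFun) (-t)‖)) := by
    intro t h
    have hpos := log_two_pi_pos.trans_le (log_two_pi_le f (-t))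
    rw [log_norm_fourierInt_sq f h, abs_neg, abs_of_pos hpos, ← div_eq_mul_inv,
      le_div_iff₀ hpos, div_le_iff₀ hpos, inv_mul_eq_div, le_div_iff₀ hd, mul_comm _ d]
  have hne : f ∈ supersmoothWith a d → ∀ t, charFun (law f.toFun) t ≠ 0 := by
    intro hf t h0
    -- At a zero the conventions `Real.log 0 = 0` and `0⁻¹ = 0` make the middle term `0`, against `0
    -- < d`.
    have h := (hf (-t)).1
    rw [fourierInt_eq_charFun, neg_neg, h0] at h
    simp at h
    linarith
  constructor
  · intro hf t
    have h := (key (-t) (by rw [neg_neg]; exact hne hf t)).1 (hf (-t))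
    rw [neg_neg, neg_sq] at h
    exact ⟨hne hf t, h⟩
  · intro h t
    have h' := h (-t)
    rw [neg_sq] at h'
    exact (key t h'.1).2 h'.2

/-- Multiplying the characteristic function by a factor in `(0, 1]` that decays slowly enough
keeps a density supersmooth, with a smaller constant. -/
theorem mem_supersmoothWith_of_charFun_mul {a d d' : ℝ} (ha : 0 < a) (hd : 0 < d) (hdd' : d < d')
    {f g : L2Density} (hf : f ∈ supersmoothWith a d') {w : ℝ → ℝ} (hw0 : ∀ t, 0 < w t)
    (hw1 : ∀ t, w t ≤ 1)
    (hw : ∀ t, -(2 * Real.log (w t)) ≤ (d⁻¹ - d'⁻¹) * (1 + t ^ 2) ^ a)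
    (hg : ∀ t, charFun (law g.toFun) t = charFun (law f.toFun) t * w t) :
    g ∈ supersmoothWith a d := by
  have hd' := hd.trans hdd'
  rw [mem_supersmoothWith_iff hd'] at hf
  rw [mem_supersmoothWith_iff hd]
  intro t
  obtain ⟨h0, h1, h2⟩ := hf t
  have hlog : Real.log ‖charFun (law g.toFun) t‖ =
      Real.log ‖charFun (law f.toFun) t‖ + Real.log (w t) := by
    rw [hg, norm_mul, Complex.norm_real, Real.norm_of_nonneg (hw0 t).le,
      Real.log_mul (norm_ne_zero_iff.2 h0) (hw0 t).ne']
  have hwn := Real.log_nonpos (hw0 t).le (hw1 t)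
  have hwt := hw t
  have hQ := one_le_one_add_sq_rpow ha.le t
  -- The slack `d⁻¹ - d'⁻¹` pays for the loss `-2 log w`; the other inequality only improves, as `w
  -- ≤ 1`.
  refine ⟨?_, ?_, ?_⟩
  · rw [hg]
    exact mul_ne_zero h0 (Complex.ofReal_ne_zero.2 (hw0 t).ne')
  · rw [hlog, ← le_div_iff₀' hd, div_eq_inv_mul]
    rw [← le_div_iff₀' hd', div_eq_inv_mul] at h1
    nlinarith
  · rw [hlog]
    nlinarith

/-- The factor `(1 - τ) tri (t / R) + τ`, with `τ` exponentially small in `R ^ (2a)`, decays at most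
like `exp (-η (1 + t²)^a / 2)`. -/
theorem exists_bandLimited_mixture_decay {a η : ℝ} (ha : 0 < a) (hη : 0 < η) :
    ∃ c : ℝ, 0 < c ∧ ∀ R : ℝ, 0 < R → ∀ t : ℝ,
      0 < (1 - Real.exp (-(c * (R ^ 2) ^ a))) * tri (t / R) + Real.exp (-(c * (R ^ 2) ^ a)) ∧
      (1 - Real.exp (-(c * (R ^ 2) ^ a))) * tri (t / R) + Real.exp (-(c * (R ^ 2) ^ a)) ≤ 1 ∧
      -(2 * Real.log ((1 - Real.exp (-(c * (R ^ 2) ^ a))) * tri (t / R) +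
        Real.exp (-(c * (R ^ 2) ^ a)))) ≤ η * (1 + t ^ 2) ^ a := by
  -- The cut at `|t| = δ R` balances two bounds: below it the triangle is at least `1 - δ = exp (-η
  -- / 2)`, and above it `τ = exp (-(η / 2) ((δ R) ^ 2) ^ a)` alone suffices.
  set δ : ℝ := 1 - Real.exp (-(η / 2)) with hδ
  have hexp1 : Real.exp (-(η / 2)) < 1 := by rw [Real.exp_lt_one_iff]; linarith
  have hδ0 : 0 < δ := by linarith
  refine ⟨η / 2 * (δ ^ 2) ^ a, by positivity, fun R hR t => ?_⟩
  set τ : ℝ := Real.exp (-(η / 2 * (δ ^ 2) ^ a * (R ^ 2) ^ a)) with hτ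
  have hτ0 : 0 < τ := Real.exp_pos _
  have hτ1 : τ ≤ 1 := by rw [hτ, Real.exp_le_one_iff, neg_nonpos]; positivity
  have h0 := tri_nonneg (t / R)
  have h1 := tri_le_one (t / R)
  have hpos : 0 < (1 - τ) * tri (t / R) + τ := by nlinarith
  refine ⟨hpos, by nlinarith, ?_⟩
  have hQ := one_le_one_add_sq_rpow ha.le t
  suffices h : -(η / 2 * (1 + t ^ 2) ^ a) ≤ Real.log ((1 - τ) * tri (t / R) + τ) by linarith
  rw [Real.le_log_iff_exp_le hpos]
  rcases le_or_gt |t| (δ * R) with h | h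
  · have h2 : 1 - δ ≤ tri (t / R) := by
      refine le_trans ?_ (one_sub_abs_le_tri _)
      rw [abs_div, abs_of_pos hR]
      have := (div_le_iff₀ hR).2 h
      linarith
    calc Real.exp (-(η / 2 * (1 + t ^ 2) ^ a)) ≤ Real.exp (-(η / 2)) := by
          rw [Real.exp_le_exp]
          nlinarith
      _ = 1 - δ := by rw [hδ]; ring
      _ ≤ tri (t / R) := h2
      _ ≤ _ := by nlinarith
  · have h2 : (δ * R) ^ 2 ≤ t ^ 2 := by
      rw [← sq_abs t]
      exact pow_le_pow_left₀ (by positivity) h.le 2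
    calc Real.exp (-(η / 2 * (1 + t ^ 2) ^ a)) ≤ τ := by
          rw [hτ, Real.exp_le_exp, neg_le_neg_iff, mul_assoc,
            ← Real.mul_rpow (by positivity) (by positivity), ← mul_pow]
          refine mul_le_mul_of_nonneg_left ?_ (by positivity)
          exact (Real.rpow_le_rpow (by positivity) h2 ha.le).trans
            (sq_rpow_le_one_add_sq_rpow ha.le t)
      _ ≤ _ := by nlinarith [mul_nonneg (sub_nonneg.2 hτ1) h0]

/-! ### Perturbations near the frequencies `±k` -/

/-- The sum of two copies of the triangle function shifted to `±k`. -/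
noncomputable def bumps (k t : ℝ) : ℝ := tri (t - k) + tri (t + k)

theorem bumps_nonneg (k t : ℝ) : 0 ≤ bumps k t := add_nonneg (tri_nonneg _) (tri_nonneg _)

theorem bumps_le_one {k : ℝ} (hk : 2 ≤ k) (t : ℝ) : bumps k t ≤ 1 := by
  rcases le_total 0 t with h | h
  · rw [bumps, tri_eq_zero (t := t + k) (by rw [le_abs]; left; linarith), add_zero]
    exact tri_le_one _
  · rw [bumps, tri_eq_zero (t := t - k) (by rw [le_abs]; right; linarith), zero_add]
    exact tri_le_one _

theorem bumps_eq_zero {k t : ℝ} (h : |t| ≤ k - 1) : bumps k t = 0 := by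
  rw [abs_le] at h
  rw [bumps, tri_eq_zero (by rw [le_abs]; right; linarith),
    tri_eq_zero (by rw [le_abs]; left; linarith), add_zero]

/-- The supports are disjoint up to endpoints. This cancellation makes the perturbation invisible
after convolution with a Fejér density of bandwidth `k - 1`. -/
theorem tri_div_mul_bumps {k : ℝ} (hk : 1 < k) (t : ℝ) : tri (t / (k - 1)) * bumps k t = 0 := by
  have hk' : 0 < k - 1 := by linarith
  rcases le_or_gt |t| (k - 1) with h | h
  · rw [bumps_eq_zero h, mul_zero]
  · rw [tri_eq_zero, zero_mul]
    rw [abs_div, abs_of_pos hk', one_le_div hk']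
    exact h.le

/-- The upper bound uses that the bumps vanish where the central triangle does not. For small `c`
the lower bound keeps the logarithm of the factor bounded, so the factor can be absorbed into the
noise. -/
theorem perturbation_mem_Icc {c θ k : ℝ} (hc0 : 0 ≤ c) (hk : 2 ≤ k) (hθ : |θ| ≤ 1)
    (t : ℝ) : (1 - c) + c * (tri t + θ / 4 * bumps k t) ∈ Set.Icc (1 - 5 / 4 * c) 1 := by
  rw [abs_le] at hθ
  have hB0 := bumps_nonneg k t
  have hB1 := bumps_le_one hk t
  have hθB : |θ * bumps k t| ≤ 1 := by
    rw [abs_le]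
    constructor <;> nlinarith
  rw [abs_le] at hθB
  have hA0 := tri_nonneg t
  have hA1 := tri_le_one t
  constructor
  · nlinarith
  · rcases le_or_gt 1 |t| with h | h
    · rw [tri_eq_zero h]
      nlinarith
    · rw [bumps_eq_zero (by linarith)]
      nlinarith

/-- The mixture `(1 - τ) μ + τ ν`. -/
noncomputable def mix (τ : ℝ) (μ ν : Measure ℝ) : Measure ℝ :=
  ENNReal.ofReal (1 - τ) • μ + ENNReal.ofReal τ • ν

theorem isProbabilityMeasure_mix {τ : ℝ} (h0 : 0 ≤ τ) (h1 : τ ≤ 1) (μ ν : Measure ℝ)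
    [IsProbabilityMeasure μ] [IsProbabilityMeasure ν] : IsProbabilityMeasure (mix τ μ ν) := by
  refine ⟨?_⟩
  simp only [mix, Measure.add_apply, Measure.smul_apply, measure_univ, smul_eq_mul, mul_one]
  rw [← ENNReal.ofReal_add (by linarith) h0, sub_add_cancel, ENNReal.ofReal_one]

theorem charFun_mix {τ : ℝ} (h0 : 0 ≤ τ) (h1 : τ ≤ 1) (μ ν : Measure ℝ)
    [IsProbabilityMeasure μ] [IsProbabilityMeasure ν] (t : ℝ) :
    charFun (mix τ μ ν) t = (1 - τ : ℝ) * charFun μ t + (τ : ℝ) * charFun ν t := by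
  have hi : ∀ (κ : Measure ℝ) [IsProbabilityMeasure κ] (r : ℝ),
      Integrable (fun x : ℝ => Complex.exp (t * x * Complex.I)) (ENNReal.ofReal r • κ) := by
    intro κ _ r
    have : IsFiniteMeasure (ENNReal.ofReal r • κ) := κ.smul_finite ENNReal.ofReal_ne_top
    refine Integrable.of_bound (by apply Continuous.aestronglyMeasurable; fun_prop) 1
      (ae_of_all _ fun x => ?_)
    rw [← Complex.ofReal_mul, Complex.norm_exp_ofReal_mul_I]
  simp only [charFun_apply_real, mix]
  rw [integral_add_measure (hi _ _) (hi _ _), integral_smul_measure, integral_smul_measure,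
    ENNReal.toReal_ofReal (by linarith), ENNReal.toReal_ofReal h0, Complex.real_smul,
    Complex.real_smul]

theorem smul_le_mix (τ : ℝ) (μ ν : Measure ℝ) : ENNReal.ofReal (1 - τ) • μ ≤ mix τ μ ν :=
  Measure.le_add_right le_rfl

/-- The measure is a modulated Fejér law mixed with an atom of mass `1 - c` at the origin; the
modulation depth `θ / 2` yields the coefficient `θ / 4`. -/
theorem exists_perturbation {c k θ : ℝ} (hc0 : 0 ≤ c) (hc1 : c ≤ 1) (hk : 1 ≤ k)
    (hθ : |θ| ≤ 1) : ∃ ν : Measure ℝ, IsProbabilityMeasure ν ∧ ∀ t, charFun ν t =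
      (((1 - c) + c * (tri t + θ / 4 * bumps k t) : ℝ) : ℂ) := by
  obtain ⟨P, hP⟩ := exists_modulated_fejer (b := 1) (k := k) (κ := θ / 2) one_pos hk
    (by rw [abs_div, abs_two]; linarith)
  refine ⟨mix c (Measure.dirac 0) (law P.toFun), isProbabilityMeasure_mix hc0 hc1 _ _,
    fun t => ?_⟩
  rw [charFun_mix hc0 hc1, hP, charFun_dirac, bumps]
  simp only [inner_zero_left, Complex.ofReal_zero, zero_mul, Complex.exp_zero, div_one]
  push_cast
  ring

theorem exists_L2Density_eq_fejerDensity {b : ℝ} (hb : 0 < b) :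
    ∃ X : L2Density, X.toFun = fejerDensity b := by
  obtain ⟨M, hM, hle⟩ := exists_fejerDensity_le
  refine exists_L2Density_of_bounded (fejerDensity_nonneg hb) (integrable_fejerDensity hb) ?_
    (fun x => hle b x hb)
  have h := integral_exp_mul_fejerDensity hb 0
  simp only [Complex.ofReal_zero, zero_mul, Complex.exp_zero, one_mul, zero_div, tri_zero] at h
  rw [integral_complex_ofReal] at h
  exact_mod_cast h

theorem hasSum_half_pow_succ : HasSum (fun j : ℕ => (1 / 2 : ℝ) ^ (j + 1)) 1 := by
  have := hasSum_geometric_two' (1 : ℝ)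
  simpa [pow_succ, div_eq_mul_inv, mul_comm] using this

/-! ### Existence of supersmooth densities -/

/-- A countable mixture of Fejér densities with geometric weights. -/
theorem exists_fejer_mixture {R : ℕ → ℝ} (hR : ∀ j, 0 < R j)
    (hsum : Summable fun j => (1 / 2 : ℝ) ^ (j + 1) * R j) :
    ∃ X : L2Density, ∀ t, ∃ φ : ℝ, charFun (law X.toFun) t = (φ : ℂ) ∧
      HasSum (fun j => (1 / 2 : ℝ) ^ (j + 1) * tri (t / R j)) φ := by
  choose X hX using fun j => exists_L2Density_eq_fejerDensity (hR j)
  obtain ⟨M, hM, hle⟩ := exists_fejerDensity_le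
  set h : ℕ → ℝ → ℝ≥0∞ := fun j x =>
    ENNReal.ofReal ((1 / 2 : ℝ) ^ (j + 1)) * ENNReal.ofReal (fejerDensity (R j) x) with hh
  have hm : ∀ j, Measurable (h j) := fun j =>
    ((continuous_fejerDensity (R j)).measurable.ennreal_ofReal).const_mul _
  have hlaw : ∀ j, volume.withDensity (h j) =
      ENNReal.ofReal ((1 / 2 : ℝ) ^ (j + 1)) • law (X j).toFun := fun j => by
    rw [law, hX, ← withDensity_smul _ (continuous_fejerDensity (R j)).measurable.ennreal_ofReal]
    rfl
  have hint : ∀ j, ∫⁻ x, h j x = ENNReal.ofReal ((1 / 2 : ℝ) ^ (j + 1)) := fun j => by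
    have := congrArg (fun μ : Measure ℝ => μ Set.univ) (hlaw j)
    simpa [withDensity_apply] using this
  have htot : ∫⁻ x, (∑' j, h j) x = 1 := by
    simp_rw [ENNReal.tsum_apply]
    rw [lintegral_tsum fun j => (hm j).aemeasurable]
    simp_rw [hint]
    rw [← ENNReal.ofReal_tsum_of_nonneg (fun j => by positivity) hasSum_half_pow_succ.summable,
      hasSum_half_pow_succ.tsum_eq, ENNReal.ofReal_one]
  have hmt : Measurable (∑' j, h j) := by
    have : (∑' j, h j) = fun x => ∑' j, h j x := funext fun x => ENNReal.tsum_apply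
    rw [this]
    exact Measurable.tsum hm
  -- Fejér densities are at most `M * R j`, so the summability hypothesis bounds the mixture, which
  -- is therefore in `L²`.
  have hbound : ∀ x, (∑' j, h j) x ≤
      ENNReal.ofReal (∑' j, M * ((1 / 2 : ℝ) ^ (j + 1) * R j)) := fun x => by
    rw [ENNReal.tsum_apply, ENNReal.ofReal_tsum_of_nonneg
      (fun j => mul_nonneg hM.le (mul_nonneg (by positivity) (hR j).le)) (hsum.mul_left M)]
    refine ENNReal.tsum_le_tsum fun j => ?_
    change ENNReal.ofReal _ * ENNReal.ofReal _ ≤ _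
    rw [← ENNReal.ofReal_mul (by positivity)]
    refine ENNReal.ofReal_le_ofReal ?_
    calc _ ≤ (1 / 2 : ℝ) ^ (j + 1) * (M * R j) :=
          mul_le_mul_of_nonneg_left (hle _ _ (hR j)) (by positivity)
      _ = _ := by ring
  obtain ⟨g, hg⟩ := exists_law_eq_withDensity hmt htot (by
    refine ne_top_of_le_ne_top (b := ENNReal.ofReal
      (∑' j, M * ((1 / 2 : ℝ) ^ (j + 1) * R j)) * 1) (by finiteness) ?_
    rw [← htot, ← lintegral_const_mul _ hmt]
    refine lintegral_mono fun x => ?_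
    rw [sq]
    gcongr
    exact hbound x)
  refine ⟨g, fun t => ?_⟩
  have hgs : law g.toFun = Measure.sum fun j =>
      ENNReal.ofReal ((1 / 2 : ℝ) ^ (j + 1)) • law (X j).toFun := by
    rw [hg, withDensity_tsum hm]
    simp_rw [hlaw]
  have hsum' : HasSum (fun j => (((1 / 2 : ℝ) ^ (j + 1) * tri (t / R j) : ℝ) : ℂ))
      (charFun (law g.toFun) t) := by
    have hi : Integrable (fun x : ℝ => Complex.exp (t * x * Complex.I)) (law g.toFun) := by
      refine Integrable.of_bound (by apply Continuous.aestronglyMeasurable; fun_prop) 1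
        (ae_of_all _ fun x => ?_)
      rw [← Complex.ofReal_mul, Complex.norm_exp_ofReal_mul_I]
    rw [charFun_apply_real]
    rw [hgs] at hi ⊢
    have he : (fun j => (((1 / 2 : ℝ) ^ (j + 1) * tri (t / R j) : ℝ) : ℂ)) =
        fun j => ∫ x : ℝ, Complex.exp (t * x * Complex.I)
          ∂(ENNReal.ofReal ((1 / 2 : ℝ) ^ (j + 1)) • law (X j).toFun) := funext fun j => by
      rw [integral_smul_measure, ← charFun_apply_real, charFun_law, hX,
        integral_exp_mul_fejerDensity (hR j), ENNReal.toReal_ofReal (by positivity),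
        Complex.real_smul, Complex.ofReal_mul]
    rw [he]
    exact hasSum_integral_measure hi
  have hs : Summable fun j => (1 / 2 : ℝ) ^ (j + 1) * tri (t / R j) :=
    Complex.summable_ofReal.1 hsum'.summable
  refine ⟨_, ?_, hs.hasSum⟩
  rw [Complex.ofReal_tsum, hsum'.tsum_eq]

/-- Mix Fejér densities with weights `2^(-(j+1))` and bandwidths satisfying `R_j^(2a) = j + 1`. At
`t` only the terms with `j + 1 > |t|^(2a)` survive, so `-log` of the characteristic function is of
order `1 + |t|^(2a)`. -/
theorem supersmooth_nonempty {a : ℝ} (ha : 0 < a) :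
    ∃ d : ℝ, 0 < d ∧ (supersmoothWith a d).Nonempty := by
  set R : ℕ → ℝ := fun j => Real.sqrt (((j : ℝ) + 1) ^ (1 / a)) with hRdef
  have hR : ∀ j, 0 < R j := fun j => by positivity
  have hRsq : ∀ j, R j ^ 2 = ((j : ℝ) + 1) ^ (1 / a) := fun j => Real.sq_sqrt (by positivity)
  have hRa : ∀ j, (R j ^ 2) ^ a = (j : ℝ) + 1 := fun j => by
    rw [hRsq, ← Real.rpow_mul (by positivity), one_div_mul_cancel ha.ne', Real.rpow_one]
  have hsum : Summable fun j => (1 / 2 : ℝ) ^ (j + 1) * R j := by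
    set N : ℕ := ⌈1 / a⌉₊
    have h1 := summable_pow_mul_geometric_of_norm_lt_one N (r := (1 / 2 : ℝ)) (by norm_num)
    have h2 : Summable fun j : ℕ => ((j + 1 : ℕ) : ℝ) ^ N * (1 / 2 : ℝ) ^ (j + 1) :=
      (summable_nat_add_iff 1).2 h1
    refine Summable.of_nonneg_of_le (fun j => mul_nonneg (by positivity) (hR j).le)
      (fun j => ?_) h2
    rw [mul_comm]
    refine mul_le_mul_of_nonneg_right ?_ (by positivity)
    have hj : (1 : ℝ) ≤ (j : ℝ) + 1 := by linarith [(Nat.cast_nonneg j : (0 : ℝ) ≤ j)]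
    have h3 : (1 : ℝ) ≤ ((j : ℝ) + 1) ^ (1 / a) := Real.one_le_rpow hj (by positivity)
    calc R j ≤ R j ^ 2 := by
          have : 1 ≤ R j := Real.one_le_sqrt.2 h3
          nlinarith
      _ = ((j : ℝ) + 1) ^ (1 / a) := hRsq j
      _ ≤ ((j : ℝ) + 1) ^ (N : ℝ) := Real.rpow_le_rpow_of_exponent_le hj (Nat.le_ceil _)
      _ = _ := by rw [Real.rpow_natCast]; push_cast; rfl
  obtain ⟨X, hX⟩ := exists_fejer_mixture hR hsum
  set c₁ : ℝ := Real.log (2 * Real.pi) + 6 * Real.log 2 + 2 * Real.log 2 * 4 ^ a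
  set c₂ : ℝ := min (Real.log (Real.pi / 2)) (2 * Real.log (4 / 3))
  have hlog2 : 0 < Real.log 2 := Real.log_pos (by norm_num)
  have hc₁ : 0 < c₁ := by
    have := log_two_pi_pos
    positivity
  have hc₂ : 0 < c₂ := lt_min (Real.log_pos (by linarith [Real.pi_gt_three]))
    (mul_pos two_pos (Real.log_pos (by norm_num)))
  have hd : 0 < min c₁⁻¹ (c₂ / 2 ^ a) := lt_min (by positivity) (by positivity)
  refine ⟨_, hd, X, (mem_supersmoothWith_iff hd X).2 fun t => ?_⟩
  obtain ⟨φ, hφ, hs⟩ := hX t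
  set y : ℝ := (t ^ 2) ^ a with hy
  have hy0 : 0 ≤ y := by positivity
  have hQ := one_le_one_add_sq_rpow ha.le t
  have hyQ : y ≤ (1 + t ^ 2) ^ a := sq_rpow_le_one_add_sq_rpow ha.le t
  -- One term suffices: `j ≥ 4 ^ a * y` means `R j ≥ 2 |t|`, where the triangle is at least `1/2`.
  have hlow : ∃ j : ℕ, (j : ℝ) ≤ 4 ^ a * y + 1 ∧ (1 / 2 : ℝ) ^ (j + 2) ≤ φ := by
    refine ⟨⌈4 ^ a * y⌉₊, (Nat.ceil_lt_add_one (by positivity)).le, ?_⟩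
    set j := ⌈4 ^ a * y⌉₊
    have hj : 4 ^ a * y ≤ j := Nat.le_ceil _
    have h1 : (4 * t ^ 2) ≤ R j ^ 2 := by
      rw [← Real.rpow_le_rpow_iff (by positivity) (by positivity) ha, hRa,
        Real.mul_rpow (by norm_num) (sq_nonneg t)]
      linarith
    have h2 : |t / R j| ≤ 1 / 2 := by
      rw [abs_div, abs_of_pos (hR j), div_le_iff₀ (hR j)]
      have : |2 * t| ≤ |R j| := sq_le_sq.1 (by nlinarith)
      rw [abs_mul, abs_two, abs_of_pos (hR j)] at this
      linarith
    have h3 : 1 / 2 ≤ tri (t / R j) := le_trans (by linarith) (one_sub_abs_le_tri _)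
    calc (1 / 2 : ℝ) ^ (j + 2) = (1 / 2) ^ (j + 1) * (1 / 2) := by ring
      _ ≤ (1 / 2) ^ (j + 1) * tri (t / R j) := by gcongr
      _ ≤ φ := le_hasSum hs j fun i _ => mul_nonneg (by positivity) (tri_nonneg _)
  -- Splitting `1/2 = (2/3) / (4/3)` leaves a summable series: surviving terms have `j + 1 > y`, so
  -- the factor `(4/3)^(-(j+1))` is at most `(4/3)^(-y)`.
  have hup : φ ≤ 2 * (4 / 3 : ℝ) ^ (-y) := by
    have hg : HasSum (fun j : ℕ => (2 / 3 : ℝ) ^ (j + 1) * (4 / 3 : ℝ) ^ (-y))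
        (2 * (4 / 3 : ℝ) ^ (-y)) := by
      have h := ((hasSum_geometric_of_lt_one (r := (2 / 3 : ℝ)) (by norm_num)
        (by norm_num)).mul_left (2 / 3)).mul_right ((4 / 3 : ℝ) ^ (-y))
      have e1 : (fun j : ℕ => (2 / 3 : ℝ) ^ (j + 1) * (4 / 3 : ℝ) ^ (-y)) =
          fun j => 2 / 3 * (2 / 3) ^ j * (4 / 3 : ℝ) ^ (-y) := funext fun j => by ring
      have e2 : 2 * (4 / 3 : ℝ) ^ (-y) = 2 / 3 * (1 - 2 / 3)⁻¹ * (4 / 3 : ℝ) ^ (-y) := by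
        norm_num
      rw [e1, e2]
      exact h
    refine hasSum_le (fun j => ?_) hs hg
    rcases le_or_gt ((j : ℝ) + 1) y with h | h
    · have h1 : R j ^ 2 ≤ t ^ 2 := by
        rw [← Real.rpow_le_rpow_iff (by positivity) (by positivity) ha, hRa]
        exact h
      have h2 : R j ≤ |t| := by
        have := sq_le_sq.1 h1
        rwa [abs_of_pos (hR j)] at this
      rw [tri_eq_zero (by rw [abs_div, abs_of_pos (hR j), one_le_div (hR j)]; exact h2), mul_zero]
      positivity
    · have h1 : (1 : ℝ) ≤ (4 / 3 : ℝ) ^ ((j : ℝ) + 1) * (4 / 3 : ℝ) ^ (-y) := by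
        rw [← Real.rpow_add (by norm_num)]
        exact Real.one_le_rpow (by norm_num) (by linarith)
      have h2 : (2 / 3 : ℝ) ^ (j + 1) = (1 / 2) ^ (j + 1) * (4 / 3 : ℝ) ^ ((j : ℝ) + 1) := by
        have : (4 / 3 : ℝ) ^ ((j : ℝ) + 1) = (4 / 3 : ℝ) ^ (j + 1) := by
          rw [← Real.rpow_natCast]; push_cast; rfl
        rw [this, ← mul_pow]
        norm_num
      rw [h2, mul_assoc]
      exact mul_le_mul_of_nonneg_left ((tri_le_one _).trans h1) (by positivity)
  obtain ⟨j, hj, hjφ⟩ := hlow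
  have hφ0 : 0 < φ := lt_of_lt_of_le (by positivity) hjφ
  have hn : ‖charFun (law X.toFun) t‖ = φ := by
    rw [hφ, Complex.norm_real, Real.norm_of_nonneg hφ0.le]
  rw [hn]
  refine ⟨by rw [hφ]; exact Complex.ofReal_ne_zero.2 hφ0.ne', ?_, ?_⟩
  · have h1 : -((j + 2 : ℕ) : ℝ) * Real.log 2 ≤ Real.log φ := by
      have := Real.log_le_log (by positivity) hjφ
      rwa [one_div, inv_pow, Real.log_inv, Real.log_pow, ← neg_mul] at this
    push_cast at h1
    have h2 : Real.log (2 * Real.pi) - 2 * Real.log φ ≤ c₁ * (1 + t ^ 2) ^ a := by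
      have h3 : (j : ℝ) + 2 ≤ (4 ^ a + 3) * (1 + t ^ 2) ^ a := by
        have : (4 : ℝ) ^ a * y ≤ 4 ^ a * (1 + t ^ 2) ^ a := by gcongr
        linarith
      have h4 := mul_le_mul_of_nonneg_right h3 hlog2.le
      have h5 := mul_le_mul_of_nonneg_left hQ log_two_pi_pos.le
      simp only [c₁]
      nlinarith
    have h0 : 0 ≤ Real.log (2 * Real.pi) - 2 * Real.log φ := by
      rw [← hn]
      exact log_two_pi_pos.le.trans (log_two_pi_le X t)
    calc _ ≤ c₁⁻¹ * (Real.log (2 * Real.pi) - 2 * Real.log φ) :=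
          mul_le_mul_of_nonneg_right (min_le_left _ _) h0
      _ ≤ c₁⁻¹ * (c₁ * (1 + t ^ 2) ^ a) := by gcongr
      _ = _ := inv_mul_cancel_left₀ hc₁.ne' _
  · have h1 : Real.log φ ≤ Real.log 2 - y * Real.log (4 / 3) := by
      have := Real.log_le_log hφ0 hup
      rw [Real.log_mul (by norm_num) (by positivity), Real.log_rpow (by norm_num)] at this
      linarith
    have h2 : c₂ * (1 + y) ≤ Real.log (2 * Real.pi) - 2 * Real.log φ := by
      have h3 : c₂ ≤ Real.log (2 * Real.pi) - 2 * Real.log 2 := by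
        refine (min_le_left _ _).trans (le_of_eq ?_)
        rw [Real.log_div Real.pi_ne_zero two_ne_zero, Real.log_mul two_ne_zero Real.pi_ne_zero]
        ring
      have h4 : c₂ * y ≤ 2 * Real.log (4 / 3) * y :=
        mul_le_mul_of_nonneg_right (min_le_right _ _) hy0
      linarith
    have h3 : (1 + t ^ 2) ^ a ≤ 2 ^ a * (1 + y) := by
      have h4 : (1 + t ^ 2) ^ a ≤ (2 * max 1 (t ^ 2)) ^ a := by
        refine Real.rpow_le_rpow (by positivity) ?_ ha.le
        linarith [le_max_left 1 (t ^ 2), le_max_right 1 (t ^ 2)]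
      refine h4.trans ?_
      rw [Real.mul_rpow (by norm_num) (by positivity)]
      refine mul_le_mul_of_nonneg_left ?_ (by positivity)
      rcases max_cases 1 (t ^ 2) with ⟨h, _⟩ | ⟨h, _⟩ <;> rw [h]
      · rw [Real.one_rpow]; linarith
      · linarith
    calc _ ≤ c₂ / 2 ^ a * (2 ^ a * (1 + y)) :=
          mul_le_mul (min_le_right _ _) h3 (by positivity) (by positivity)
      _ = c₂ * (1 + y) := by field_simp
      _ ≤ _ := h2

/-! ### The signals: Sobolev bound and separation -/

/-- The characteristic function of the density `q(x) (1 + κ cos(kx))`, where `q` is the Fejér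
density of bandwidth `b`. -/
noncomputable def signalChar (b k κ t : ℝ) : ℝ :=
  tri (t / b) + κ / 2 * (tri ((t - k) / b) + tri ((t + k) / b))

theorem signalChar_nonneg {κ : ℝ} (hκ : 0 ≤ κ) (b k t : ℝ) : 0 ≤ signalChar b k κ t := by
  have h1 := tri_nonneg (t / b)
  have h2 := tri_nonneg ((t - k) / b)
  have h3 := tri_nonneg ((t + k) / b)
  unfold signalChar
  positivity

theorem abs_le_of_tri_ne_zero {b v : ℝ} (hb : 0 < b) (h : tri (v / b) ≠ 0) : |v| ≤ b := by
  by_contra hlt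
  rw [not_le] at hlt
  exact h (tri_eq_zero (by rw [abs_div, abs_of_pos hb, one_le_div hb]; exact hlt.le))

/-- On the shifted bumps the weight is at most `4 ^ p * (k ^ 2) ^ p`, which the square of the height
`κ = k^(-p)` cancels exactly. The integral of the right side does not depend on `k`. -/
theorem rpow_mul_signalChar_sq_le {p b k : ℝ} (hp : 0 < p) (hb0 : 0 < b) (hb1 : b ≤ 1)
    (hk : 2 ≤ k) (t : ℝ) :
    (1 + t ^ 2) ^ p * signalChar b k ((k ^ 2) ^ (-(p / 2))) t ^ 2 ≤
      3 * 4 ^ p * (tri (t / b) + tri ((t - k) / b) + tri ((t + k) / b)) := by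
  set κ : ℝ := (k ^ 2) ^ (-(p / 2)) with hκdef
  have hk2 : 0 < k ^ 2 := by positivity
  have hκ0 : 0 < κ := by positivity
  have hκsq : κ ^ 2 * (k ^ 2) ^ p = 1 := by
    rw [hκdef, ← Real.rpow_natCast, ← Real.rpow_mul hk2.le, ← Real.rpow_add hk2]
    norm_num
  have hsq : ∀ v, tri v ^ 2 ≤ tri v := fun v => by nlinarith [tri_nonneg v, tri_le_one v]
  have hQ0 : 0 ≤ (1 + t ^ 2) ^ p := by positivity
  have h0 : (1 + t ^ 2) ^ p * tri (t / b) ^ 2 ≤ 4 ^ p * tri (t / b) := by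
    rcases eq_or_ne (tri (t / b)) 0 with h | h
    · simp [h]
    · have ht := abs_le_of_tri_ne_zero hb0 h
      have ht2 : t ^ 2 ≤ 1 := by rw [sq_le_one_iff_abs_le_one]; linarith
      exact mul_le_mul (Real.rpow_le_rpow (by positivity) (by linarith) hp.le) (hsq _)
        (sq_nonneg _) (by positivity)
  have hshift : ∀ v, |t| ≤ k + |v| → (1 + t ^ 2) ^ p * (κ ^ 2 * tri (v / b) ^ 2) ≤
      4 ^ p * tri (v / b) := by
    intro v htv
    rcases eq_or_ne (tri (v / b)) 0 with h | h
    · simp [h]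
    · have hv := abs_le_of_tri_ne_zero hb0 h
      have ht2 : t ^ 2 ≤ (k + 1) ^ 2 := by
        rw [← sq_abs t]
        exact pow_le_pow_left₀ (abs_nonneg t) (by linarith) 2
      have h1 : (1 + t ^ 2) ^ p ≤ 4 ^ p * (k ^ 2) ^ p := by
        rw [← Real.mul_rpow (by norm_num) hk2.le]
        exact Real.rpow_le_rpow (by positivity) (by nlinarith) hp.le
      have h3 := tri_nonneg (v / b)
      calc (1 + t ^ 2) ^ p * (κ ^ 2 * tri (v / b) ^ 2)
          ≤ (4 ^ p * (k ^ 2) ^ p) * (κ ^ 2 * tri (v / b)) := by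
            have := hsq (v / b)
            gcongr
        _ = 4 ^ p * (κ ^ 2 * (k ^ 2) ^ p) * tri (v / b) := by ring
        _ = _ := by rw [hκsq, mul_one]
  have h1 := hshift (t - k) (by
    have := abs_sub_abs_le_abs_sub t k
    rw [abs_of_pos (by linarith : (0 : ℝ) < k)] at this
    linarith)
  have h2 := hshift (t + k) (by
    have := abs_sub_abs_le_abs_sub t (-k)
    rw [abs_neg, abs_of_pos (by linarith : (0 : ℝ) < k), sub_neg_eq_add] at this
    linarith)
  set x := tri (t / b)
  set y := tri ((t - k) / b)
  set z := tri ((t + k) / b)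
  have hcs : signalChar b k κ t ^ 2 ≤ 3 * (x ^ 2 + κ ^ 2 * y ^ 2 + κ ^ 2 * z ^ 2) := by
    have e : signalChar b k κ t = x + κ * y / 2 + κ * z / 2 := by
      simp only [signalChar, x, y, z]
      ring
    rw [e]
    nlinarith [sq_nonneg (x - κ * y / 2), sq_nonneg (x - κ * z / 2),
      sq_nonneg (κ * y / 2 - κ * z / 2), sq_nonneg (κ * y), sq_nonneg (κ * z)]
  calc (1 + t ^ 2) ^ p * signalChar b k κ t ^ 2
      ≤ (1 + t ^ 2) ^ p * (3 * (x ^ 2 + κ ^ 2 * y ^ 2 + κ ^ 2 * z ^ 2)) :=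
        mul_le_mul_of_nonneg_left hcs hQ0
    _ ≤ _ := by linarith

theorem integrable_tri_affine {b : ℝ} (hb : 0 < b) (e : ℝ) :
    Integrable (fun u : ℝ => tri ((-(2 * Real.pi * u) + e) / b)) ∧
      ∫ u : ℝ, tri ((-(2 * Real.pi * u) + e) / b) = b / (2 * Real.pi) * ∫ v, tri v := by
  have hc : -(2 * Real.pi) / b ≠ 0 := by
    have : 2 * Real.pi / b ≠ 0 := by positivity
    rwa [neg_div, neg_ne_zero]
  have he : (fun u : ℝ => tri ((-(2 * Real.pi * u) + e) / b)) =
      fun u => (fun v => tri (v + e / b)) (-(2 * Real.pi) / b * u) := by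
    funext u
    congr 1
    ring
  rw [he]
  refine ⟨(integrable_tri.comp_add_right (e / b)).comp_mul_left' hc, ?_⟩
  rw [Measure.integral_comp_mul_left (fun v => tri (v + e / b)),
    integral_add_right_eq_self (fun v => tri v) (e / b),
    smul_eq_mul, neg_div, inv_neg, abs_neg, inv_div, abs_of_pos (by positivity)]

/-- The Sobolev norm is at most a constant, free of `k`, times the bandwidth, so shrinking `b` fits
every such signal into the ball. -/
theorem exists_bandwidth {p ρ : ℝ} (hp : 0 < p) (hρ : 0 < ρ) :
    ∃ b : ℝ, 0 < b ∧ b ≤ 1 ∧ ∀ k : ℝ, 2 ≤ k → ∀ f : L2Density,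
      (∀ t, ‖charFun (law f.toFun) t‖ ≤ signalChar b k ((k ^ 2) ^ (-(p / 2))) t) →
      f ∈ sobolevDensities p ρ := by
  set I : ℝ := ∫ v, tri v
  have hI : 0 ≤ I := integral_nonneg tri_nonneg
  set K : ℝ := 3 * 4 ^ p * (3 * (I / (2 * Real.pi))) with hK
  have hK0 : 0 ≤ K := by positivity
  have hb0 : 0 < min 1 (ρ / (K + 1)) := lt_min one_pos (by positivity)
  refine ⟨min 1 (ρ / (K + 1)), hb0, min_le_left _ _, fun k hk f hf => ?_⟩
  set b := min 1 (ρ / (K + 1)) with hb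
  have hbK : K * b ≤ ρ := by
    have : b * (K + 1) ≤ ρ := (le_div_iff₀ (by positivity)).1 (min_le_right _ _)
    nlinarith
  have hint : ∀ e, Integrable fun u : ℝ => tri ((-(2 * Real.pi * u) + e) / b) :=
    fun e => (integrable_tri_affine hb0 e).1
  have hsum : Integrable fun u : ℝ => 3 * 4 ^ p * (tri ((-(2 * Real.pi * u) + 0) / b) +
      tri ((-(2 * Real.pi * u) + -k) / b) + tri ((-(2 * Real.pi * u) + k) / b)) :=
    (((hint 0).add (hint (-k))).add (hint k)).const_mul _
  rw [sobolevDensities, Set.mem_ofPred_eq, sobolevSq_toL2]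
  calc ∫⁻ u, ENNReal.ofReal ((1 + (2 * Real.pi * u) ^ 2) ^ p *
        ‖charFun (law f.toFun) (-(2 * Real.pi * u))‖ ^ 2)
      ≤ ∫⁻ u, ENNReal.ofReal (3 * 4 ^ p * (tri ((-(2 * Real.pi * u) + 0) / b) +
          tri ((-(2 * Real.pi * u) + -k) / b) + tri ((-(2 * Real.pi * u) + k) / b))) := by
        refine lintegral_mono fun u => ENNReal.ofReal_le_ofReal ?_
        have h := rpow_mul_signalChar_sq_le hp hb0 (min_le_left _ _) hk (-(2 * Real.pi * u))
        rw [neg_sq] at h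
        rw [add_zero, ← sub_eq_add_neg]
        refine le_trans ?_ h
        gcongr
        exact hf _
    _ = ENNReal.ofReal (∫ u, 3 * 4 ^ p * (tri ((-(2 * Real.pi * u) + 0) / b) +
          tri ((-(2 * Real.pi * u) + -k) / b) + tri ((-(2 * Real.pi * u) + k) / b))) := by
        refine (ofReal_integral_eq_lintegral_ofReal hsum (ae_of_all _ fun u => ?_)).symm
        exact mul_nonneg (by positivity)
          (add_nonneg (add_nonneg (tri_nonneg _) (tri_nonneg _)) (tri_nonneg _))
    _ ≤ ENNReal.ofReal ρ := by
        refine ENNReal.ofReal_le_ofReal (le_trans (le_of_eq ?_) hbK)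
        have h01 : Integrable fun u : ℝ => tri ((-(2 * Real.pi * u) + 0) / b) +
            tri ((-(2 * Real.pi * u) + -k) / b) := (hint 0).add (hint (-k))
        rw [integral_const_mul, integral_add h01 (hint k), integral_add (hint 0) (hint (-k)),
          (integrable_tri_affine hb0 _).2, (integrable_tri_affine hb0 _).2,
          (integrable_tri_affine hb0 _).2, hK]
        ring

/-- Two densities whose characteristic functions differ by a bump at `±k` are separated on the
frequency band `[k, k + b / 2]`. -/
theorem le_bandNorm_sq {b k κ c : ℝ} (hb0 : 0 < b) (hb1 : b ≤ 1) (hκ : 0 ≤ κ) (hc : 0 ≤ c)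
    {f₁ f₂ : L2Density}
    (h : ∀ t, charFun (law f₁.toFun) t - charFun (law f₂.toFun) t =
      ((signalChar b k κ t * (c / 2 * bumps k t) : ℝ) : ℂ)) :
    (c * κ / 16) ^ 2 * (b / (4 * Real.pi)) ≤
      bandNorm (Set.Icc (k / (2 * Real.pi)) ((k + b / 2) / (2 * Real.pi)))
        (f₁.toL2 - f₂.toL2) ^ 2 := by
  have hpi : 0 < 2 * Real.pi := by positivity
  have hF : (𝓕 (f₁.toL2 - f₂.toL2) : Lp ℂ 2 (volume : Measure ℝ)) =
      𝓕 f₁.toL2 - 𝓕 f₂.toL2 := map_sub (Lp.fourierTransformₗᵢ ℝ ℂ) _ _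
  rw [← ENNReal.ofReal_le_ofReal_iff (sq_nonneg _), ofReal_bandNorm_sq,
    ENNReal.ofReal_mul (sq_nonneg _)]
  have hvol : volume (Set.Icc (k / (2 * Real.pi)) ((k + b / 2) / (2 * Real.pi))) =
      ENNReal.ofReal (b / (4 * Real.pi)) := by
    rw [Real.volume_Icc]
    congr 1
    field_simp
    ring
  rw [← hvol, ← setLIntegral_const]
  refine lintegral_mono_ae ?_
  filter_upwards [ae_restrict_mem measurableSet_Icc,
    ae_restrict_of_ae (fourier_toL2_ae f₁), ae_restrict_of_ae (fourier_toL2_ae f₂),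
    ae_restrict_of_ae (Lp.coeFn_sub (𝓕 f₁.toL2 : Lp ℂ 2 (volume : Measure ℝ)) (𝓕 f₂.toL2))]
    with u hu h1 h2 h3
  rw [hF, h3, Pi.sub_apply, h1, h2, h, Complex.norm_real, Real.norm_eq_abs, sq_abs]
  refine ENNReal.ofReal_le_ofReal (pow_le_pow_left₀ (by positivity) ?_ 2)
  rw [Set.mem_Icc, div_le_iff₀ hpi, le_div_iff₀ hpi] at hu
  -- The sign in the Fourier convention sends the band at `+k` to the bump at `-k`, so the terms in
  -- `t + k` carry the bound.
  set t : ℝ := -(2 * Real.pi * u) with ht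
  have ht1 : 0 ≤ -(t + k) := by linarith
  have ht2 : -(t + k) ≤ b / 2 := by linarith
  have hb' : |t + k| ≤ b / 2 := by rw [abs_le]; constructor <;> linarith
  have h4 : 1 / 2 ≤ tri ((t + k) / b) := by
    refine le_trans ?_ (one_sub_abs_le_tri _)
    rw [abs_div, abs_of_pos hb0]
    have : |t + k| / b ≤ 1 / 2 := by rw [div_le_iff₀ hb0]; linarith
    linarith
  have h5 : 1 / 2 ≤ tri (t + k) := le_trans (by linarith) (one_sub_abs_le_tri _)
  have h6 : κ / 4 ≤ signalChar b k κ t := by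
    have h7 := tri_nonneg (t / b)
    have h8 := tri_nonneg ((t - k) / b)
    unfold signalChar
    nlinarith
  have h7 : c / 4 ≤ c / 2 * bumps k t := by
    have h8 := tri_nonneg (t - k)
    unfold bumps
    nlinarith
  calc c * κ / 16 = κ / 4 * (c / 4) := by ring
    _ ≤ _ := mul_le_mul h6 h7 (by positivity) (le_trans (by positivity) h6)

/-! ### Common components of the sample laws -/

theorem half_le_pi_univ {τ : ℝ} {N : ℕ} (hτ1 : τ ≤ 1) (h : N * τ ≤ 1 / 2)
    (Γ : Measure ℝ) [IsProbabilityMeasure Γ] :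
    ENNReal.ofReal (1 / 2) ≤
      Measure.pi (fun _ : Fin N => ENNReal.ofReal (1 - τ) • Γ) Set.univ := by
  have : IsFiniteMeasure (ENNReal.ofReal (1 - τ) • Γ) := Γ.smul_finite ENNReal.ofReal_ne_top
  rw [Measure.pi_univ]
  simp only [Measure.smul_apply, measure_univ, smul_eq_mul, mul_one, Finset.prod_const,
    Finset.card_univ, Fintype.card_fin]
  rw [← ENNReal.ofReal_pow (by linarith)]
  refine ENNReal.ofReal_le_ofReal ?_
  -- Bernoulli's inequality: `(1 - τ) ^ N ≥ 1 - N τ`.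
  have := one_add_mul_le_pow (a := -τ) (by linarith) N
  rw [← sub_eq_add_neg] at this
  linarith

/-- If the laws of `Y` share a component of mass `1 - τ` and the laws of `ε` agree, then the
sample laws share a component of mass at least `1/2`. -/
theorem exists_le_sampleLaw_of_signal {n m : ℕ} {τ : ℝ} (hτ1 : τ ≤ 1) (h : n * τ ≤ 1 / 2)
    {f₁ f₂ ε : L2Density} {Γ : Measure ℝ} [IsProbabilityMeasure Γ]
    (h₁ : ENNReal.ofReal (1 - τ) • Γ ≤ law f₁.toFun ∗ law ε.toFun)
    (h₂ : ENNReal.ofReal (1 - τ) • Γ ≤ law f₂.toFun ∗ law ε.toFun) :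
    ∃ G : Measure ((Fin n → ℝ) × (Fin m → ℝ)), G ≤ sampleLaw n m f₁ ε ∧
      G ≤ sampleLaw n m f₂ ε ∧ ENNReal.ofReal (1 / 2) ≤ G Set.univ := by
  have : IsFiniteMeasure (ENNReal.ofReal (1 - τ) • Γ) := Γ.smul_finite ENNReal.ofReal_ne_top
  refine ⟨(Measure.pi fun _ : Fin n => ENNReal.ofReal (1 - τ) • Γ).prod
    (Measure.pi fun _ : Fin m => law ε.toFun), ?_, ?_, ?_⟩
  · rw [sampleLaw_eq]
    exact Measure.prod_mono (pi_mono_measure fun _ => h₁) le_rfl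
  · rw [sampleLaw_eq]
    exact Measure.prod_mono (pi_mono_measure fun _ => h₂) le_rfl
  · rw [← Set.univ_prod_univ, Measure.prod_prod,
      measure_univ (μ := Measure.pi fun _ : Fin m => law ε.toFun), mul_one]
    exact half_le_pi_univ hτ1 h Γ

/-- If the laws of `ε` share a component of mass `1 - τ` and the laws of `Y` agree, then the
sample laws share a component of mass at least `1/2`. -/
theorem exists_le_sampleLaw_of_noise {n m : ℕ} {τ : ℝ} (hτ1 : τ ≤ 1) (h : m * τ ≤ 1 / 2)
    {f₁ f₂ ε₁ ε₂ : L2Density} {Γ : Measure ℝ} [IsProbabilityMeasure Γ]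
    (hY : law f₁.toFun ∗ law ε₁.toFun = law f₂.toFun ∗ law ε₂.toFun)
    (h₁ : ENNReal.ofReal (1 - τ) • Γ ≤ law ε₁.toFun)
    (h₂ : ENNReal.ofReal (1 - τ) • Γ ≤ law ε₂.toFun) :
    ∃ G : Measure ((Fin n → ℝ) × (Fin m → ℝ)), G ≤ sampleLaw n m f₁ ε₁ ∧
      G ≤ sampleLaw n m f₂ ε₂ ∧ ENNReal.ofReal (1 / 2) ≤ G Set.univ := by
  have : IsFiniteMeasure (ENNReal.ofReal (1 - τ) • Γ) := Γ.smul_finite ENNReal.ofReal_ne_top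
  refine ⟨(Measure.pi fun _ : Fin n => law f₁.toFun ∗ law ε₁.toFun).prod
    (Measure.pi fun _ : Fin m => ENNReal.ofReal (1 - τ) • Γ), ?_, ?_, ?_⟩
  · rw [sampleLaw_eq]
    exact Measure.prod_mono le_rfl (pi_mono_measure fun _ => h₁)
  · rw [sampleLaw_eq, hY]
    exact Measure.prod_mono le_rfl (pi_mono_measure fun _ => h₂)
  · rw [← Set.univ_prod_univ, Measure.prod_prod, measure_univ, one_mul]
    exact half_le_pi_univ hτ1 h Γ

/-! ### Choice of the frequency and the lower bound -/

/-- The frequency `k` with `k ^ (2a) = K log N` is detectable only with a sample size larger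
than `N`. -/
theorem exists_frequency_scale {a c : ℝ} (ha : 0 < a) (hc : 0 < c) :
    ∃ K : ℝ, 0 < K ∧ ∀ N : ℕ, 2 ≤ N → ∃ k : ℝ, 2 ≤ k ∧ k ^ 2 = (K * Real.log N) ^ a⁻¹ ∧
      N * Real.exp (-(c * ((k - 1) ^ 2) ^ a)) ≤ 1 / 2 := by
  have hlog2 : 0 < Real.log 2 := Real.log_pos (by norm_num)
  -- The first entry forces `k ≥ 2`, hence `k - 1 ≥ k / 2`; with that, the second makes the
  -- exponential at most `N ^ (-2)`.
  set K : ℝ := max (4 ^ a / Real.log 2) (2 * 4 ^ a / c) with hK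
  have hK0 : 0 < K := lt_max_of_lt_left (by positivity)
  refine ⟨K, hK0, fun N hN => ?_⟩
  have hN' : (2 : ℝ) ≤ N := by exact_mod_cast hN
  have hlogN : Real.log 2 ≤ Real.log N := Real.log_le_log (by norm_num) hN'
  have hlogN0 : 0 < Real.log N := hlog2.trans_le hlogN
  set x : ℝ := (K * Real.log N) ^ a⁻¹ with hx
  have hx0 : 0 < x := by positivity
  have hxa : x ^ a = K * Real.log N := by
    rw [hx, ← Real.rpow_mul (by positivity), inv_mul_cancel₀ ha.ne', Real.rpow_one]
  have hsq : Real.sqrt x ^ 2 = x := Real.sq_sqrt hx0.le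
  have h4 : 4 ≤ x := by
    rw [← Real.rpow_le_rpow_iff (by norm_num) hx0.le ha, hxa]
    have h1 : 4 ^ a / Real.log 2 ≤ K := le_max_left _ _
    rw [div_le_iff₀ hlog2] at h1
    nlinarith
  have hk2 : 2 ≤ Real.sqrt x := by
    rw [Real.le_sqrt' (by norm_num)]
    linarith
  refine ⟨Real.sqrt x, hk2, hsq, ?_⟩
  have h5 : x / 4 ≤ (Real.sqrt x - 1) ^ 2 := by
    nlinarith [mul_nonneg (sub_nonneg.2 hk2) (by linarith : (0 : ℝ) ≤ 3 * Real.sqrt x - 2)]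
  have h6 : 2 * Real.log N ≤ c * ((Real.sqrt x - 1) ^ 2) ^ a := by
    have h7 : 2 * 4 ^ a / c ≤ K := le_max_right _ _
    rw [div_le_iff₀ hc] at h7
    have h8 : (x / 4) ^ a ≤ ((Real.sqrt x - 1) ^ 2) ^ a :=
      Real.rpow_le_rpow (by positivity) h5 ha.le
    rw [Real.div_rpow hx0.le (by norm_num), hxa, div_le_iff₀ (by positivity)] at h8
    have h9 : (0 : ℝ) < 4 ^ a := by positivity
    refine le_of_mul_le_mul_right ?_ h9
    nlinarith
  calc N * Real.exp (-(c * ((Real.sqrt x - 1) ^ 2) ^ a))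
      ≤ N * Real.exp (-(2 * Real.log N)) := by gcongr
    _ = (N : ℝ)⁻¹ := by
      rw [two_mul, neg_add, Real.exp_add, Real.exp_neg, Real.exp_log (by linarith)]
      field_simp
    _ ≤ 1 / 2 := by
      rw [one_div]
      exact inv_anti₀ (by norm_num) hN'

/-- The two-point bound at a frequency `k ≥ 2` that one of the samples cannot detect: the two signals
differ near `k`, with a common noise density if `n` is small, and with noise densities that give
the same law of `Y` if `m` is small. -/
theorem exists_minimax_lower_bound_at_frequency {a p s ρ d d' : ℝ} (ha : 0 < a)
    (hs : 0 ≤ s) (hsp : s < p) (hρ : 0 < ρ) (hd : 0 < d) (hdd' : d < d')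
    (hne : (supersmoothWith a d').Nonempty) :
    ∃ c C : ℝ, 0 < c ∧ 0 < C ∧ ∀ k : ℝ, 2 ≤ k → ∀ n m : ℕ,
      (n * Real.exp (-(c * ((k - 1) ^ 2) ^ a)) ≤ 1 / 2 ∨
        m * Real.exp (-(c * ((k - 1) ^ 2) ^ a)) ≤ 1 / 2) →
      ENNReal.ofReal (C * (k ^ 2) ^ (s - p)) ≤
        minimaxRisk n m s (sobolevDensities p ρ) (supersmoothWith a d) := by
  obtain ⟨f, hf⟩ := hne
  have hp : 0 < p := hs.trans_lt hsp
  have hd' := hd.trans hdd'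
  -- Half of the available slack goes to the band-limited mixture, the other half to the
  -- perturbation factor.
  set η : ℝ := (d⁻¹ - d'⁻¹) / 2 with hη
  have hη0 : 0 < η := by
    have := inv_strictAnti₀ hd hdd'
    rw [hη]
    linarith
  obtain ⟨c₀, hc₀, hw⟩ := exists_bandLimited_mixture_decay ha hη0
  obtain ⟨b, hb0, hb1, hsob⟩ := exists_bandwidth hp hρ
  -- Chosen so that the lower bound `1 - 5 / 4 * c` of the perturbation equals `exp (-η / 2)`, a
  -- cost of at most `η` in `-2 log`.
  set c : ℝ := 4 / 5 * (1 - Real.exp (-(η / 2))) with hc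
  have hexp1 : Real.exp (-(η / 2)) < 1 := by rw [Real.exp_lt_one_iff]; linarith
  have hexp0 := Real.exp_pos (-(η / 2))
  have hc0 : 0 < c := by rw [hc]; linarith
  have hc1 : c ≤ 1 := by rw [hc]; linarith
  have hcη : 1 - 5 / 4 * c = Real.exp (-(η / 2)) := by rw [hc]; ring
  refine ⟨c₀, (c / 16) ^ 2 * (b / (4 * Real.pi)) / 8, hc₀, by positivity,
    fun k hk n m hnm => ?_⟩
  have hk2 : 0 < k ^ 2 := by positivity
  set R : ℝ := k - 1 with hR
  have hR0 : 0 < R := by linarith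
  set κ : ℝ := (k ^ 2) ^ (-(p / 2)) with hκdef
  have hκ0 : 0 < κ := by positivity
  have hκ1 : κ ≤ 1 := Real.rpow_le_one_of_one_le_of_nonpos (by nlinarith) (by linarith)
  set τ : ℝ := Real.exp (-(c₀ * (R ^ 2) ^ a)) with hτ
  have hτ0 : 0 ≤ τ := (Real.exp_pos _).le
  have hτ1 : τ ≤ 1 := by rw [hτ, Real.exp_le_one_iff, neg_nonpos]; positivity
  obtain ⟨X, hX⟩ := exists_modulated_fejer (b := b) (k := k) (κ := κ) hb0 (by linarith)
    (by rw [abs_of_pos hκ0]; exact hκ1)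
  obtain ⟨ν₁, hν₁p, hν₁⟩ := exists_perturbation (c := c) (k := k) (θ := 1) hc0.le hc1
    (by linarith) (by simp)
  obtain ⟨ν₂, hν₂p, hν₂⟩ := exists_perturbation (c := c) (k := k) (θ := -1) hc0.le hc1
    (by linarith) (by simp)
  have hI₁ : ∀ t, _ := perturbation_mem_Icc (c := c) (θ := 1) (k := k) hc0.le hk (by simp)
  have hI₂ : ∀ t, _ := perturbation_mem_Icc (c := c) (θ := -1) (k := k) hc0.le hk (by simp)
  obtain ⟨f₁, hf₁⟩ := exists_law_eq_conv X ν₁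
  obtain ⟨f₂, hf₂⟩ := exists_law_eq_conv X ν₂
  have hmem : ∀ (g : L2Density) (ν : Measure ℝ) (w : ℝ → ℝ), IsProbabilityMeasure ν →
      law g.toFun = law X.toFun ∗ ν → (∀ t, charFun ν t = (w t : ℂ)) →
      (∀ t, w t ∈ Set.Icc (1 - 5 / 4 * c) 1) → g ∈ sobolevDensities p ρ := by
    intro g ν w _ hg hν hwt
    refine hsob k hk g fun t => ?_
    have h0 : 0 ≤ w t := by
      have := (hwt t).1
      rw [hcη] at this
      exact hexp0.le.trans this
    have h1 := signalChar_nonneg hκ0.le b k t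
    rw [hg, charFun_conv, hX, hν, norm_mul, Complex.norm_real, Complex.norm_real,
      Real.norm_of_nonneg h0, Real.norm_eq_abs]
    change |signalChar b k κ t| * w t ≤ signalChar b k κ t
    rw [abs_of_nonneg h1]
    exact mul_le_of_le_one_right h1 (hwt t).2
  have hf₁m := hmem f₁ ν₁ _ hν₁p hf₁ hν₁ hI₁
  have hf₂m := hmem f₂ ν₂ _ hν₂p hf₂ hν₂ hI₂
  have hdiff : ∀ t, charFun (law f₁.toFun) t - charFun (law f₂.toFun) t =
      ((signalChar b k κ t * (c / 2 * bumps k t) : ℝ) : ℂ) := by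
    intro t
    rw [hf₁, hf₂, charFun_conv, charFun_conv, hν₁, hν₂, hX, signalChar]
    push_cast
    ring
  have hsep := le_bandNorm_sq hb0 hb1 hκ0.le hc0.le hdiff
  obtain ⟨F, hF⟩ := exists_fejer_density hR0
  have hμp : IsProbabilityMeasure (mix τ (law F.toFun) (Measure.dirac 0)) :=
    isProbabilityMeasure_mix hτ0 hτ1 _ _
  have hμ : ∀ t, charFun (mix τ (law F.toFun) (Measure.dirac 0)) t =
      (((1 - τ) * tri (t / R) + τ : ℝ) : ℂ) := by
    intro t
    rw [charFun_mix hτ0 hτ1, hF, charFun_dirac]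
    simp
  have hTB : ∀ t, ((tri (t / R) : ℝ) : ℂ) * ((bumps k t : ℝ) : ℂ) = 0 := by
    intro t
    rw [← Complex.ofReal_mul, tri_div_mul_bumps (by linarith), Complex.ofReal_zero]
  suffices hΓ : ∃ ε₁ ∈ supersmoothWith a d, ∃ ε₂ ∈ supersmoothWith a d,
      ∃ G : Measure ((Fin n → ℝ) × (Fin m → ℝ)), G ≤ sampleLaw n m f₁ ε₁ ∧
        G ≤ sampleLaw n m f₂ ε₂ ∧ ENNReal.ofReal (1 / 2) ≤ G Set.univ by
    obtain ⟨ε₁, hε₁, ε₂, hε₂, G, hG₁, hG₂, hG⟩ := hΓ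
    have hrisk := ofReal_le_minimaxRisk (s := s) (W := (k ^ 2) ^ s)
      (S := Set.Icc (k / (2 * Real.pi)) ((k + b / 2) / (2 * Real.pi))) measurableSet_Icc
      (by positivity) (fun u hu => by
        rw [Set.mem_Icc, div_le_iff₀ (by positivity)] at hu
        exact Real.rpow_le_rpow hk2.le (by nlinarith [hu.1]) hs) hf₁m hf₂m hε₁ hε₂ hG₁ hG₂ hG
    refine le_trans (ENNReal.ofReal_le_ofReal ?_) hrisk
    have hκsq : κ ^ 2 = (k ^ 2) ^ (-p) := by
      rw [hκdef, ← Real.rpow_natCast, ← Real.rpow_mul hk2.le]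
      congr 1
      push_cast
      ring
    have hpow : (k ^ 2) ^ (s - p) = (k ^ 2) ^ s * κ ^ 2 := by
      rw [hκsq, ← Real.rpow_add hk2, sub_eq_add_neg]
    calc _ = (k ^ 2) ^ s * ((c * κ / 16) ^ 2 * (b / (4 * Real.pi))) / 8 := by
          rw [hpow]
          ring
      _ ≤ _ := by gcongr
  rcases hnm with hn | hm
  · obtain ⟨ε, hε⟩ := exists_law_eq_conv f (mix τ (law F.toFun) (Measure.dirac 0))
    have hεm : ε ∈ supersmoothWith a d := by
      refine mem_supersmoothWith_of_charFun_mul ha hd hdd' hf (fun t => (hw R hR0 t).1)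
        (fun t => (hw R hR0 t).2.1) (fun t => ?_) (fun t => ?_)
      · refine (hw R hR0 t).2.2.trans (mul_le_mul_of_nonneg_right ?_ (by positivity))
        linarith
      · rw [hε, charFun_conv, hμ]
    -- The `F`-part of the noise removes the bumps, so `g ∗ F` and `f₁ ∗ F` coincide; only the part
    -- of weight `τ` still depends on `g`.
    have hcomp : ∀ (g : L2Density) (θ : ℝ), (∀ t, charFun (law g.toFun) t =
          charFun (law X.toFun) t * (((1 - c) + c * (tri t + θ / 4 * bumps k t) : ℝ) : ℂ)) →
        ENNReal.ofReal (1 - τ) • (law f₁.toFun ∗ (law f.toFun ∗ law F.toFun)) ≤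
          law g.toFun ∗ law ε.toFun := by
      intro g θ hg
      have hmixp := isProbabilityMeasure_mix hτ0 hτ1
        (law f₁.toFun ∗ (law f.toFun ∗ law F.toFun)) (law g.toFun ∗ law f.toFun)
      have heq : law g.toFun ∗ law ε.toFun =
          mix τ (law f₁.toFun ∗ (law f.toFun ∗ law F.toFun)) (law g.toFun ∗ law f.toFun) := by
        refine Measure.ext_of_charFun (funext fun t => ?_)
        rw [charFun_mix hτ0 hτ1]
        simp only [charFun_conv, hε, hf₁, hν₁, hμ, hF, hg]
        push_cast
        linear_combination (1 - (τ : ℂ)) * charFun (law X.toFun) t * charFun (law f.toFun) t *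
          c * (θ / 4 - 1 / 4) * hTB t
      rw [heq]
      exact smul_le_mix _ _ _
    exact ⟨ε, hεm, ε, hεm, exists_le_sampleLaw_of_signal hτ1 hn
      (hcomp f₁ 1 fun t => by rw [hf₁, charFun_conv, hν₁])
      (hcomp f₂ (-1) fun t => by rw [hf₂, charFun_conv, hν₂])⟩
  -- The perturbations are swapped between signal and noise: each product of characteristic
  -- functions contains `ν₁` and `ν₂` once, so `Y` carries no information.
  · obtain ⟨ε₁, hε₁⟩ := exists_law_eq_conv f (mix τ (law F.toFun) (Measure.dirac 0) ∗ ν₂)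
    obtain ⟨ε₂, hε₂⟩ := exists_law_eq_conv f (mix τ (law F.toFun) (Measure.dirac 0) ∗ ν₁)
    have hεm : ∀ (ε : L2Density) (ν : Measure ℝ) (v : ℝ → ℝ), IsProbabilityMeasure ν →
        law ε.toFun = law f.toFun ∗ (mix τ (law F.toFun) (Measure.dirac 0) ∗ ν) →
        (∀ t, charFun ν t = (v t : ℂ)) → (∀ t, v t ∈ Set.Icc (1 - 5 / 4 * c) 1) →
        ε ∈ supersmoothWith a d := by
      intro ε ν v _ hε hν hv
      have hv0 : ∀ t, Real.exp (-(η / 2)) ≤ v t := fun t => hcη ▸ (hv t).1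
      refine mem_supersmoothWith_of_charFun_mul ha hd hdd' hf
        (w := fun t => ((1 - τ) * tri (t / R) + τ) * v t)
        (fun t => mul_pos (hw R hR0 t).1 (hexp0.trans_le (hv0 t)))
        (fun t => mul_le_one₀ (hw R hR0 t).2.1 (hexp0.le.trans (hv0 t)) (hv t).2)
        (fun t => ?_) (fun t => ?_)
      · have h1 := (hw R hR0 t).2.2
        have h2 : -(η / 2) ≤ Real.log (v t) :=
          (Real.le_log_iff_exp_le (hexp0.trans_le (hv0 t))).2 (hv0 t)
        rw [Real.log_mul (hw R hR0 t).1.ne' (hexp0.trans_le (hv0 t)).ne']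
        have hQ := one_le_one_add_sq_rpow ha.le t
        have h3 : d⁻¹ - d'⁻¹ = 2 * η := by rw [hη]; ring
        rw [h3]
        nlinarith
      · rw [hε, charFun_conv, charFun_conv, hμ, hν]
        push_cast
        ring
    have hε₁m := hεm ε₁ ν₂ _ hν₂p hε₁ hν₂ hI₂
    have hε₂m := hεm ε₂ ν₁ _ hν₁p hε₂ hν₁ hI₁
    have hY : law f₁.toFun ∗ law ε₁.toFun = law f₂.toFun ∗ law ε₂.toFun := by
      refine Measure.ext_of_charFun (funext fun t => ?_)
      simp only [charFun_conv, hε₁, hε₂, hf₁, hf₂]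
      ring
    have hcomp : ∀ (ε : L2Density) (ν : Measure ℝ) (θ : ℝ), IsProbabilityMeasure ν →
        law ε.toFun = law f.toFun ∗ (mix τ (law F.toFun) (Measure.dirac 0) ∗ ν) →
        (∀ t, charFun ν t = (((1 - c) + c * (tri t + θ / 4 * bumps k t) : ℝ) : ℂ)) →
        ENNReal.ofReal (1 - τ) • (law f.toFun ∗ (law F.toFun ∗ ν₁)) ≤ law ε.toFun := by
      intro ε ν θ _ hε hν
      have hmixp := isProbabilityMeasure_mix hτ0 hτ1
        (law f.toFun ∗ (law F.toFun ∗ ν₁)) (law f.toFun ∗ ν)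
      have heq : law ε.toFun =
          mix τ (law f.toFun ∗ (law F.toFun ∗ ν₁)) (law f.toFun ∗ ν) := by
        refine Measure.ext_of_charFun (funext fun t => ?_)
        rw [charFun_mix hτ0 hτ1]
        simp only [charFun_conv, hε, hν₁, hμ, hF, hν]
        push_cast
        linear_combination (1 - (τ : ℂ)) * charFun (law f.toFun) t *
          c * (θ / 4 - 1 / 4) * hTB t
      rw [heq]
      exact smul_le_mix _ _ _
    exact ⟨ε₁, hε₁m, ε₂, hε₂m, exists_le_sampleLaw_of_noise hτ1 hm hY
      (hcomp ε₁ ν₂ (-1) hν₂p hε₁ hν₂) (hcomp ε₂ ν₁ 1 hν₁p hε₂ hν₁)⟩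

/-- The frequency is tuned once to `n` and once to `m`; the larger of the two resulting bounds is at
least half their sum. -/
theorem exists_minimax_lower_bound {a p s ρ d d' : ℝ} (ha : 0 < a) (hs : 0 ≤ s) (hsp : s < p)
    (hρ : 0 < ρ) (hd : 0 < d) (hdd' : d < d') (hne : (supersmoothWith a d').Nonempty) :
    ∃ C : ℝ, 0 < C ∧ ∀ n m : ℕ, 2 ≤ n → 2 ≤ m →
      ENNReal.ofReal
          (C * ((Real.log n) ^ (-(p - s) / a) + (Real.log m) ^ (-(p - s) / a))) ≤
        minimaxRisk n m s (sobolevDensities p ρ) (supersmoothWith a d) := by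
  obtain ⟨c, C, hc, hC, hrisk⟩ :=
    exists_minimax_lower_bound_at_frequency ha hs hsp hρ hd hdd' hne
  obtain ⟨K, hK, hfreq⟩ := exists_frequency_scale ha hc
  set γ : ℝ := -(p - s) / a with hγ
  have hKγ : 0 < K ^ γ := by positivity
  have hlog : ∀ N : ℕ, 2 ≤ N → 0 < Real.log N := fun N hN =>
    Real.log_pos (by exact_mod_cast hN)
  have hpow : ∀ (N : ℕ) (k : ℝ), 2 ≤ N → k ^ 2 = (K * Real.log N) ^ a⁻¹ →
      C * (k ^ 2) ^ (s - p) = C * K ^ γ * Real.log N ^ γ := by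
    intro N k hN hk
    have h0 := hlog N hN
    rw [hk, ← Real.rpow_mul (by positivity), mul_assoc, ← Real.mul_rpow hK.le h0.le]
    congr 2
    rw [hγ]
    ring
  refine ⟨C * K ^ γ / 2, by positivity, fun n m hn hm => ?_⟩
  obtain ⟨k, hk2, hk, hkn⟩ := hfreq n hn
  obtain ⟨l, hl2, hl, hlm⟩ := hfreq m hm
  have h1 := hrisk k hk2 n m (Or.inl hkn)
  have h2 := hrisk l hl2 n m (Or.inr hlm)
  rw [hpow n k hn hk] at h1
  rw [hpow m l hm hl] at h2
  have h3 := Real.rpow_pos_of_pos (hlog n hn) γ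
  have h4 := Real.rpow_pos_of_pos (hlog m hm) γ
  rcases le_total (Real.log n ^ γ) (Real.log m ^ γ) with h | h
  · refine le_trans (ENNReal.ofReal_le_ofReal ?_) h2
    have := mul_le_mul_of_nonneg_left h (by positivity : 0 ≤ C * K ^ γ)
    linarith
  · refine le_trans (ENNReal.ofReal_le_ofReal ?_) h1
    have := mul_le_mul_of_nonneg_left h (by positivity : 0 ≤ C * K ^ γ)
    linarith

end Deconvolution

theorem corollary4p9 (a p s ρ : ℝ) (ha : 0 < a) (hs : 0 ≤ s) (hsp : s < p) (hρ : 0 < ρ) :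
    (∃ C : ℝ, 0 < C ∧ ∀ n m : ℕ, 2 ≤ n → 2 ≤ m →
      ENNReal.ofReal
          (C * ((Real.log n) ^ (-(p - s) / a) + (Real.log m) ^ (-(p - s) / a))) ≤
        Deconvolution.minimaxRisk n m s
          (Deconvolution.sobolevDensities p ρ) (Deconvolution.supersmooth a)) ∧
    (∀ d d' : ℝ, 0 < d → d < d' → (Deconvolution.supersmoothWith a d').Nonempty →
      ∃ C : ℝ, 0 < C ∧ ∀ n m : ℕ, 2 ≤ n → 2 ≤ m →
        ENNReal.ofReal
            (C * ((Real.log n) ^ (-(p - s) / a) + (Real.log m) ^ (-(p - s) / a))) ≤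
          Deconvolution.minimaxRisk n m s
            (Deconvolution.sobolevDensities p ρ) (Deconvolution.supersmoothWith a d)) := by
  refine ⟨?_, fun d d' hd hdd' hne =>
    Deconvolution.exists_minimax_lower_bound ha hs hsp hρ hd hdd' hne⟩
  -- The union over all constants contains the class with constant `d' / 2`, and the minimax risk is
  -- monotone in the class.
  obtain ⟨d', hd', hne⟩ := Deconvolution.supersmooth_nonempty ha
  obtain ⟨C, hC, h⟩ := Deconvolution.exists_minimax_lower_bound ha hs hsp hρ (half_pos hd')
    (half_lt_self hd') hne
  refine ⟨C, hC, fun n m hn hm => (h n m hn hm).trans ?_⟩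
  refine iInf₂_mono fun T _ => iSup₂_mono fun f _ => ?_
  exact biSup_mono fun ε hε => ⟨d' / 2, half_pos hd', hε⟩
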